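/- **Setting.** For $c\ge 0$, $\kappa\in\mathbb{R}$ consider the travelling wave equation $$icu'+u''+u(1-|u|^2)+\kappa u(1-|u|^2)''=0\quad\text{on }\mathbb{R},\qquad(\mathrm{TW})$$ in the energy space $\mathcal{X}(\mathbb{R})=\{v\in H^1_{\mathrm{loc}}(\mathbb{R};\mathbb{C}):1-|v|^2\in L^2(\mathbb{R}),\ v'\in L^2(\mathbb{R})\}$. With $\langle z,w\rangle=\operatorname{Re}(z\bar w)$, a function $u\in\mathcal{X}(\mathbb{R})$ is a (weak) solution if for all $\phi\in C_0^\infty(\mathbb{R};\mathbb{C})$ $$\int_{\mathbb{R}}\langle icu'+u(1-|u|^2),\phi\rangle-\langle u',\phi'\rangle+2\kappa\langle u,u'\rangle\langle u,\phi\rangle'=0 .$$ Let $$\mathcal{D}_1=\{0\le c<\sqrt2,\ 0<\kappa<\tfrac12\},\quad \mathcal{D}_3=\{c>\sqrt2,\ \kappa>\tfrac12\},\quad \mathcal{B}_-=\{c=\sqrt2,\ 0<\kappa<\tfrac12\},\quad \mathcal{B}_+=\{c=\sqrt2,\ \kappa>\tfrac12\},$$ and $\tilde{\mathcal{D}}=\mathcal{D}_1\cup\mathcal{D}_3\cup\mathcal{B}_-\cup\mathcal{B}_+$.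 Put $\mathfrak{T}_\kappa=[1-\frac1{2\kappa},0)$ if $0<\kappa<\frac12$, $\mathfrak{J}_\kappa=(0,1-\frac1{2\kappa}]$ if $\kappa>\frac12$, and $$f_{c,\kappa}(y)=2\sqrt\kappa\arctan\Big(\sqrt\kappa\sqrt{\tfrac{2-c^2-2y}{1-2\kappa+2\kappa y}}\Big)+2\sqrt{\tfrac{1-2\kappa}{2-c^2}}\operatorname{artanh}\Big(\sqrt{\tfrac{(2-c^2)(1-2\kappa+2\kappa y)}{(1-2\kappa)(2-c^2-2y)}}\Big)-\pi\sqrt\kappa$$ for $y\in\mathfrak{T}_\kappa$, $(c,\kappa)\in\mathcal{D}_1$; $h_{c,\kappa}$ is given by the same formula for $y\in\mathfrak{J}_\kappa$, $(c,\kappa)\in\mathcal{D}_3$; $$g_\kappa(y)=2\sqrt\kappa\arctan\Big(\sqrt{\tfrac{-2\kappa y}{1-2\kappa+2\kappa y}}\Big)+\sqrt2\sqrt{-\tfrac{1-2\kappa+2\kappa y}{y}}-\pi\sqrt\kappa$$ for $y\in\mathfrak{T}_\kappa$, $0<\kappa<\frac12$; $\tilde g_\kappa$ is given by the same formula for $y\in\mathfrak{J}_\kappa$,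 $\kappa>\frac12$. At $y=1-\frac1{2\kappa}$, where the denominator $1-2\kappa+2\kappa y$ vanishes, $\arctan$ is read as $\frac\pi2$, so that these functions take the value $0$ there. **Theorem.** Let $(c,\kappa)\in\tilde{\mathcal{D}}$ and let $u\in\mathcal{X}(\mathbb{R})$ be a weak solution of (TW). Then $u$ has a (unique) continuous representative, with which it is identified. Suppose that $u$ is singular, i.e. $u\notin C^2(\mathbb{R})$, and that the critical set $\Gamma=\{x\in\mathbb{R}:|u(x)|^2=\frac1{2\kappa}\}$ is nonempty and bounded, normalised by a translation so that $\sup\Gamma=0$. Let $\mathfrak{a}=\inf\Gamma$ and $\eta=1-|u|^2$. Then: 1. In the corresponding regions, $f_{c,\kappa}$, $g_\kappa$ are bijections from $\mathfrak{T}_\kappa$ onto $[0,\infty)$ and $h_{c,\kappa}$, $\tilde g_\kappa$ are bijections from $\mathfrak{J}_\kappa$ onto $[0,\infty)$, and for all $x\ge0$: $\eta(x)=f_{c,\kappa}^{-1}(x)$ if $(c,\kappa)\in\mathcal{D}_1$, $\eta(x)=h_{c,\kappa}^{-1}(x)$ if $(c,\kappa)\in\mathcal{D}_3$, $\eta(x)=g_\kappa^{-1}(x)$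 if $(c,\kappa)\in\mathcal{B}_-$, $\eta(x)=\tilde g_\kappa^{-1}(x)$ if $(c,\kappa)\in\mathcal{B}_+$. 2. $\eta(x)=\eta(\mathfrak{a}-x)$ for all $x\le\mathfrak{a}$. 3. For all $x\in(-\infty,\mathfrak{a})\cup(0,\infty)$: $1-\frac1{2\kappa}<\eta(x)<0$ if $(c,\kappa)\in\mathcal{D}_1\cup\mathcal{B}_-$, and $0<\eta(x)<1-\frac1{2\kappa}$ if $(c,\kappa)\in\mathcal{D}_3\cup\mathcal{B}_+$. 4. There is a real function $\theta$ such that, on $(-\infty,\mathfrak{a})\cup(0,\infty)$, $u=\sqrt{1-\eta}\,e^{i\theta}$ and $\theta$ is differentiable with $\theta'=\dfrac{c\,\eta}{2-2\eta}$. 5. $u$ is $C^\infty$ on $(-\infty,\mathfrak{a})\cup(0,\infty)$ (and continuous on $\mathbb{R}$). 6. $\eta'(\mathfrak{a}^-)=-\infty$ and $\eta'(0^+)=+\infty$ if $(c,\kappa)\in\mathcal{D}_1\cup\mathcal{B}_-$, while $\eta'(\mathfrak{a}^-)=+\infty$ and $\eta'(0^+)=-\infty$ if $(c,\kappa)\in\mathcal{D}_3\cup\mathcal{B}_+$.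 7. For every integer $j\ge0$ there are constants $C_1,C_2,C_3>0$ such that for all $x\ge1$: $|D^ju'(x)|+|D^j\eta(x)|\le C_1e^{-C_2x}$ if $(c,\kappa)\in\mathcal{D}_1\cup\mathcal{D}_3$, and $|D^ju'(x)|+|D^j\eta(x)|\le C_3x^{-(2+j)}$ if $(c,\kappa)\in\mathcal{B}_+\cup\mathcal{B}_-$. -/

import Mathlib

open Set Filter Topology MeasureTheory
open scoped ContDiff

namespace Cuspon

noncomputable section

/-- `g` is the weak (distributional) derivative of `f` on `ℝ`. -/
def HasWeakDeriv (f g : ℝ → ℂ) : Prop :=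
  LocallyIntegrable f volume ∧ LocallyIntegrable g volume ∧
    ∀ φ : ℝ → ℝ, ContDiff ℝ ∞ φ → HasCompactSupport φ →
      ∫ x, deriv φ x • f x = - ∫ x, φ x • g x

/-- The energy space `{v ∈ H¹_loc(ℝ; ℂ) : 1 - |v|² ∈ L²(ℝ), v' ∈ L²(ℝ)}`, `v'` being the weak
derivative. Membership depends only on the almost-everywhere class of the function. -/
def EnergySpace : Set (ℝ → ℂ) :=
  {v | (∀ K : Set ℝ, IsCompact K → MemLp v 2 (volume.restrict K)) ∧
    (∃ g : ℝ → ℂ, HasWeakDeriv v g ∧ MemLp g 2 volume) ∧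
    MemLp (fun x => 1 - ‖v x‖ ^ 2) 2 volume}

/-- Weak solutions of the travelling wave equation
`i c u' + u'' + u (1 - |u|²) + κ u (1 - |u|²)'' = 0`, tested against `φ ∈ C₀^∞(ℝ; ℂ)` with the real
scalar product `⟨z, w⟩ = Re (z * conj w)` on `ℂ`. Here `g = u'`, and the last bracket is the
derivative of `⟨u, φ⟩`. -/
def IsWeakSolution (c κ : ℝ) (u : ℝ → ℂ) : Prop :=
  ∃ g : ℝ → ℂ, HasWeakDeriv u g ∧
    ∀ φ : ℝ → ℂ, ContDiff ℝ ∞ φ → HasCompactSupport φ →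
      ∫ x, (inner ℝ (Complex.I * (c : ℂ) * g x + u x * ((1 - ‖u x‖ ^ 2 : ℝ) : ℂ)) (φ x)
        - inner ℝ (g x) (deriv φ x)
        + 2 * κ * inner ℝ (u x) (g x) *
            (inner ℝ (g x) (φ x) + inner ℝ (u x) (deriv φ x))) = 0

/-- The intensity profile `η = 1 - |u|²`. -/
def intensity (u : ℝ → ℂ) (x : ℝ) : ℝ := 1 - ‖u x‖ ^ 2

/-- The critical set `Γ(u) = {x : |u(x)|² = 1/(2κ)}`. -/
def criticalSet (κ : ℝ) (u : ℝ → ℂ) : Set ℝ := {x | ‖u x‖ ^ 2 = 1 / (2 * κ)}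

/-! Parameter regions for `(c, κ)`. -/

def D1 : Set (ℝ × ℝ) := {p | 0 ≤ p.1 ∧ p.1 < √2 ∧ 0 < p.2 ∧ p.2 < 1 / 2}

def D3 : Set (ℝ × ℝ) := {p | √2 < p.1 ∧ 1 / 2 < p.2}

def BMinus : Set (ℝ × ℝ) := {p | p.1 = √2 ∧ 0 < p.2 ∧ p.2 < 1 / 2}

def BPlus : Set (ℝ × ℝ) := {p | p.1 = √2 ∧ 1 / 2 < p.2}

def DTilde : Set (ℝ × ℝ) := D1 ∪ D3 ∪ BMinus ∪ BPlus

/-! Domains of the profile functions. -/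

/-- `[1 - 1/(2κ), 0)`, used for `0 < κ < 1/2`. -/
def intervalT (κ : ℝ) : Set ℝ := Ico (1 - 1 / (2 * κ)) 0

/-- `(0, 1 - 1/(2κ)]`, used for `κ > 1/2`. -/
def intervalJ (κ : ℝ) : Set ℝ := Ioc 0 (1 - 1 / (2 * κ))

/-- The function `f_{c,κ}` on `intervalT κ`. At the endpoint `y = 1 - 1/(2κ)` the denominator
`1 - 2κ + 2κy` vanishes, the arctangent there is read as `arctan (+∞) = π/2`, and the value of the
formula is `0`. -/
def profileF (c κ y : ℝ) : ℝ :=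
  if y = 1 - 1 / (2 * κ) then 0
  else
    2 * √κ * Real.arctan (√κ * √((2 - c ^ 2 - 2 * y) / (1 - 2 * κ + 2 * κ * y)))
      + 2 * √((1 - 2 * κ) / (2 - c ^ 2)) *
          Real.artanh (√(((2 - c ^ 2) * (1 - 2 * κ + 2 * κ * y)) /
            ((1 - 2 * κ) * (2 - c ^ 2 - 2 * y))))
      - Real.pi * √κ

/-- The function `h_{c,κ}` on `intervalJ κ`, given by the same formula as `f_{c,κ}`. -/
def profileH (c κ y : ℝ) : ℝ := profileF c κ y

/-- The function `g_κ` on `intervalT κ`, with the same reading at `y = 1 - 1/(2κ)`. -/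
def profileG (κ y : ℝ) : ℝ :=
  if y = 1 - 1 / (2 * κ) then 0
  else
    2 * √κ * Real.arctan (√((-2 * κ * y) / (1 - 2 * κ + 2 * κ * y)))
      + √2 * √(-((1 - 2 * κ + 2 * κ * y) / y))
      - Real.pi * √κ

/-- The function `g̃_κ` on `intervalJ κ`, given by the same formula as `g_κ`. -/
def profileGTilde (κ y : ℝ) : ℝ := profileG κ y

/-- `η` is given on `[0, ∞)` by the inverse of `F : S → [0, ∞)`; that `F` is a bijection of `S`
onto `[0, ∞)` is part of the assertion. -/
def EqInverseOnNonneg (η F : ℝ → ℝ) (S : Set ℝ) : Prop :=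
  BijOn F S (Ici 0) ∧ ∀ x, 0 ≤ x → η x = Function.invFunOn F S x

end

end Cuspon

/-!
The equation in divergence form makes the flux `u' - 2κ⟨u, u'⟩u`
absolutely continuous. Off `Γ` the flux determines `u'`, so `u` is smooth there and conserves a
momentum and an energy. Finite energy fixes the two constants, which gives `2⟨iu, u'⟩ = cη` and
`(1 - 2κ + 2κη) η'² = η² (2 - c² - 2η)`. With `η = (2κ - 1) ξ` all four regions lead to one
equation for a profile `ξ > 0` that starts from its largest value `1/(2κ)`. Its slope `r = -ξ'/ξ`
solves an autonomous equation `r' = -(r² - α²) (1 + κr²) / (2 (1 + κα²))` and decreases from `∞` to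
the decay rate `α`; integrating `1/r'` gives the position as an explicit function of `ξ`. Finally
`u'` and `η` are `r² - α²` times quantities that stay bounded, and so are all their derivatives, by
the equation for `r`; for `α = 0` each derivative gains a factor `r ~ 2/x`.
-/

namespace Cuspon

open scoped InnerProductSpace

/-! ### Weak derivatives on the line -/

theorem intervalIntegrable_of_locallyIntegrable {E : Type*} [NormedAddCommGroup E] {f : ℝ → E}
    (hf : LocallyIntegrable f) (a b : ℝ) : IntervalIntegrable f volume a b :=
  (hf.integrableOn_isCompact isCompact_uIcc).intervalIntegrable

section Primitives

variable {E : Type*} [NormedAddCommGroup E] [NormedSpace ℝ E]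

theorem exists_compactSupport_primitive [CompleteSpace E] {ρ : ℝ → E} (hρ : ContDiff ℝ ∞ ρ)
    (hsupp : HasCompactSupport ρ) (hmean : ∫ x, ρ x = 0) :
    ∃ φ : ℝ → E, ContDiff ℝ ∞ φ ∧ HasCompactSupport φ ∧ deriv φ = ρ := by
  obtain ⟨R, -, hR⟩ := hsupp.isCompact.isBounded.subset_closedBall_lt 0 0
  rw [Real.closedBall_eq_Icc, zero_sub, zero_add] at hR
  have hzero : ∀ x ∉ Icc (-R) R, ρ x = 0 := fun x hx =>
    image_eq_zero_of_notMem_tsupport fun h => hx (hR h)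
  have hderiv : ∀ x, HasDerivAt (fun x => ∫ t in (-R - 1)..x, ρ t) (ρ x) x := fun x =>
    intervalIntegral.integral_hasDerivAt_right (hρ.continuous.intervalIntegrable _ _)
      hρ.continuous.aestronglyMeasurable.stronglyMeasurableAtFilter hρ.continuous.continuousAt
  have hderiv_eq : deriv (fun x => ∫ t in (-R - 1)..x, ρ t) = ρ :=
    funext fun x => (hderiv x).deriv
  refine ⟨_, contDiff_infty_iff_deriv.2
    ⟨fun x => (hderiv x).differentiableAt, by rwa [hderiv_eq]⟩, ?_, hderiv_eq⟩
  refine HasCompactSupport.intro (isCompact_Icc (a := -R - 1) (b := R)) fun x hx => ?_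
  rcases lt_or_ge x (-R - 1) with hleft | hleft
  · refine intervalIntegral.integral_zero_ae (ae_of_all _ fun t ht => hzero t fun h => ?_)
    rw [uIoc_of_ge hleft.le] at ht
    linarith [ht.2, h.1]
  · have hright : R < x := not_le.1 fun h => hx ⟨hleft, h⟩
    rw [← hmean]
    refine intervalIntegral.integral_eq_integral_of_support_subset fun t ht => ?_
    have := hR (subset_tsupport _ ht)
    exact ⟨by linarith [this.1], by linarith [this.2]⟩

/-- Lemma of du Bois-Reymond. -/
theorem ae_eq_const_of_integral_deriv_smul_eq_zero [CompleteSpace E] {f : ℝ → E}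
    (hf : LocallyIntegrable f)
    (h : ∀ φ : ℝ → ℝ, ContDiff ℝ ∞ φ → HasCompactSupport φ → ∫ x, deriv φ x • f x = 0) :
    ∃ C : E, ∀ᵐ x, f x = C := by
  let b : ContDiffBump (0 : ℝ) := default
  set χ : ℝ → ℝ := b.normed volume
  have hχ : ContDiff ℝ ∞ χ := b.contDiff_normed
  have hχsupp : HasCompactSupport χ := b.hasCompactSupport_normed
  have hχint : ∫ x, χ x = 1 := b.integral_normed
  refine ⟨∫ x, χ x • f x, ae_eq_of_integral_contDiff_smul_eq hf
    (locallyIntegrable_const _) fun ψ hψ hψsupp => ?_⟩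
  have integrable_smul : ∀ g : ℝ → ℝ, Continuous g → HasCompactSupport g →
      Integrable (fun x => g x • f x) := fun g hg hgsupp =>
    hf.integrable_smul_left_of_hasCompactSupport hg hgsupp
  have hψint : Integrable ψ := hψ.continuous.integrable_of_hasCompactSupport hψsupp
  -- `ψ - (∫ ψ) χ` has mean zero, so it is the derivative of a test function
  obtain ⟨φ, hφ, hφsupp, hφderiv⟩ := exists_compactSupport_primitive
    (ρ := fun x => ψ x - (∫ y, ψ y) * χ x) (hψ.sub (contDiff_const.mul hχ))
    (hψsupp.sub hχsupp.mul_left) (by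
      rw [integral_sub hψint ((hχ.continuous.integrable_of_hasCompactSupport hχsupp).const_mul _),
        integral_const_mul, hχint, mul_one, sub_self])
  have hφf := h φ hφ hφsupp
  simp only [hφderiv, sub_smul, mul_smul] at hφf
  rw [integral_sub (integrable_smul ψ hψ.continuous hψsupp)
    ((integrable_smul χ hχ.continuous hχsupp).fun_smul _), integral_smul, sub_eq_zero] at hφf
  rw [hφf, integral_smul_const]

theorem continuous_primitive_of_locallyIntegrable {f : ℝ → E} (hf : LocallyIntegrable f) (a : ℝ) :
    Continuous fun x => ∫ t in a..x, f t :=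
  intervalIntegral.continuous_primitive (intervalIntegrable_of_locallyIntegrable hf) a

theorem integral_deriv_mul_primitive {f φ : ℝ → ℝ} (hf : LocallyIntegrable f)
    (hφ : ContDiff ℝ 1 φ) (hsupp : HasCompactSupport φ) :
    ∫ x, deriv φ x * (∫ t in (0 : ℝ)..x, f t) = -∫ x, φ x * f x := by
  obtain ⟨R, hRpos, hR⟩ := hsupp.isCompact.isBounded.subset_closedBall_lt 0 0
  rw [Real.closedBall_eq_Icc, zero_sub, zero_add] at hR
  have hzero : ∀ x ∉ Icc (-R) R, φ x = 0 := fun x hx =>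
    image_eq_zero_of_notMem_tsupport fun h => hx (hR h)
  have integral_eq : ∀ g : ℝ → ℝ, Function.support g ⊆ tsupport φ →
      ∫ x in (-R - 1)..(R + 1), g x = ∫ x, g x := fun g hg =>
    intervalIntegral.integral_eq_integral_of_support_subset fun x hx => by
      have := hR (hg hx)
      exact ⟨by linarith [this.1], by linarith [this.2]⟩
  have hparts := AbsolutelyContinuousOnInterval.integral_mul_deriv_eq_deriv_mul
    (f := φ) (g := fun x => ∫ t in (0 : ℝ)..x, f t) (a := -R - 1) (b := R + 1)
    hφ.contDiffOn.absolutelyContinuousOnInterval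
    ((intervalIntegrable_of_locallyIntegrable hf _ _
      ).absolutelyContinuousOnInterval_intervalIntegral
        (by rw [uIcc_of_le (by linarith)]; constructor <;> linarith))
  rw [integral_eq _ ((Function.support_mul_subset_left _ _).trans (subset_tsupport _)),
    integral_eq _ ((Function.support_mul_subset_left _ _).trans support_deriv_subset),
    hzero (R + 1) fun h => by linarith [h.2], hzero (-R - 1) fun h => by linarith [h.1]] at hparts
  have hae : ∫ x, φ x * deriv (fun x => ∫ t in (0 : ℝ)..x, f t) x = ∫ x, φ x * f x := by
    refine integral_congr_ae ?_
    filter_upwards [_root_.LocallyIntegrable.ae_hasDerivAt_integral hf] with x hx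
    rw [(hx 0).deriv]
  linarith

theorem integral_deriv_smul_primitive [CompleteSpace E] {f : ℝ → E} {φ : ℝ → ℝ}
    (hf : LocallyIntegrable f) (hφ : ContDiff ℝ 1 φ) (hsupp : HasCompactSupport φ) :
    ∫ x, deriv φ x • (∫ t in (0 : ℝ)..x, f t) = -∫ x, φ x • f x := by
  refine (SeparatingDual.eq_iff_forall_dual_eq (R := ℝ)).2 fun ℓ => ?_
  have hℓf : LocallyIntegrable (fun x => ℓ (f x)) := fun x =>
    let ⟨s, hs, hfs⟩ := hf x; ⟨s, hs, ℓ.integrable_comp hfs⟩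
  rw [map_neg, ← ℓ.integral_comp_comm (hf.integrable_smul_left_of_hasCompactSupport
      hφ.continuous hsupp), ← ℓ.integral_comp_comm
      ((continuous_primitive_of_locallyIntegrable hf 0).locallyIntegrable
        |>.integrable_smul_left_of_hasCompactSupport (hφ.continuous_deriv le_rfl) hsupp.deriv)]
  simp only [map_smul, smul_eq_mul,
    ← ℓ.intervalIntegral_comp_comm (intervalIntegrable_of_locallyIntegrable hf _ _)]
  exact integral_deriv_mul_primitive hℓf hφ hsupp

theorem ae_eq_primitive_of_integral_deriv_smul [CompleteSpace E] {f f' : ℝ → E}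
    (hf : LocallyIntegrable f) (hf' : LocallyIntegrable f')
    (h : ∀ φ : ℝ → ℝ, ContDiff ℝ ∞ φ → HasCompactSupport φ →
      ∫ x, deriv φ x • f x = -∫ x, φ x • f' x) :
    ∃ C : E, ∀ᵐ x, f x = C + ∫ t in (0 : ℝ)..x, f' t := by
  have hprim := (continuous_primitive_of_locallyIntegrable hf' 0).locallyIntegrable (μ := volume)
  obtain ⟨C, hC⟩ := ae_eq_const_of_integral_deriv_smul_eq_zero (hf.sub hprim) fun φ hφ hsupp => by
    have hφ' : Continuous (deriv φ) := hφ.continuous_deriv (by simp)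
    simp only [Pi.sub_apply, smul_sub]
    rw [integral_sub (hf.integrable_smul_left_of_hasCompactSupport hφ' hsupp.deriv)
        (hprim.integrable_smul_left_of_hasCompactSupport hφ' hsupp.deriv), h φ hφ hsupp,
      integral_deriv_smul_primitive hf' (hφ.of_le (by simp)) hsupp, sub_self]
  exact ⟨C, hC.mono fun x hx => sub_eq_iff_eq_add.1 hx⟩

theorem hasDerivAt_primitive_of_ae_eq [CompleteSpace E] {f g : ℝ → E} {s : Set ℝ} {a x : ℝ}
    (hs : IsOpen s) (hf : LocallyIntegrable f) (hfg : ∀ᵐ y, y ∈ s → f y = g y)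
    (hg : ContinuousOn g s) (hx : x ∈ s) :
    HasDerivAt (fun x => ∫ t in a..x, f t) (g x) x := by
  obtain ⟨t, ht, hft⟩ := hf x
  refine intervalIntegral.integral_hasDerivAt_of_tendsto_ae_right
    (intervalIntegrable_of_locallyIntegrable hf _ _) ⟨t, ht, hft.aestronglyMeasurable⟩
    ((hg.continuousAt (hs.mem_nhds hx)).tendsto.mono_left inf_le_left |>.congr' ?_)
  filter_upwards [mem_inf_of_left (hs.mem_nhds hx), mem_inf_of_right hfg] with y hy hfgy
    using (hfgy hy).symm

end Primitives

theorem HasWeakDeriv.ae_eq_primitive {f g : ℝ → ℂ} (h : HasWeakDeriv f g) :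
    ∃ C : ℂ, ∀ᵐ x, f x = C + ∫ t in (0 : ℝ)..x, g t :=
  ae_eq_primitive_of_integral_deriv_smul h.1 h.2.1 h.2.2

theorem HasWeakDeriv.unique {f g g' : ℝ → ℂ} (h : HasWeakDeriv f g) (h' : HasWeakDeriv f g') :
    g =ᵐ[volume] g' :=
  ae_eq_of_integral_contDiff_smul_eq h.2.1 h'.2.1 fun φ hφ hsupp =>
    neg_injective ((h.2.2 φ hφ hsupp).symm.trans (h'.2.2 φ hφ hsupp))

theorem HasWeakDeriv.exists_continuous {f g : ℝ → ℂ} (h : HasWeakDeriv f g) :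
    ∃ f' : ℝ → ℂ, Continuous f' ∧ f' =ᵐ[volume] f ∧ HasWeakDeriv f' g := by
  obtain ⟨C, hC⟩ := h.ae_eq_primitive
  have hcont : Continuous fun x => C + ∫ t in (0 : ℝ)..x, g t :=
    continuous_const.add (continuous_primitive_of_locallyIntegrable h.2.1 0)
  have hae : (fun x => C + ∫ t in (0 : ℝ)..x, g t) =ᵐ[volume] f := hC.mono fun x hx => hx.symm
  refine ⟨_, hcont, hae, hcont.locallyIntegrable, h.2.1, fun φ hφ hsupp => ?_⟩
  rw [← h.2.2 φ hφ hsupp]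
  refine integral_congr_ae ?_
  filter_upwards [hae] with x hx
  rw [hx]

theorem HasWeakDeriv.hasDerivAt {f g p : ℝ → ℂ} {s : Set ℝ} {x : ℝ} (h : HasWeakDeriv f g)
    (hf : Continuous f) (hs : IsOpen s) (hgp : ∀ᵐ y, y ∈ s → g y = p y) (hp : ContinuousOn p s)
    (hx : x ∈ s) : HasDerivAt f (p x) x := by
  obtain ⟨C, hC⟩ := h.ae_eq_primitive
  rw [(hf.ae_eq_iff_eq _ (continuous_const.add
    (continuous_primitive_of_locallyIntegrable h.2.1 0))).1 hC]
  exact (hasDerivAt_primitive_of_ae_eq hs h.2.1 hgp hp hx).const_add C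

theorem contDiffOn_of_hasDerivAt_comp {E : Type*} [NormedAddCommGroup E] [NormedSpace ℝ E]
    {f : ℝ → E} {V : E → E} {I : Set ℝ} {U : Set E} (hI : IsOpen I)
    (hV : ContDiffOn ℝ ∞ V U) (hfU : MapsTo f I U) (hf : ∀ x ∈ I, HasDerivAt f (V (f x)) x) :
    ContDiffOn ℝ ∞ f I := by
  rw [contDiffOn_infty]
  intro n
  induction n with
  | zero => exact contDiffOn_zero.2 fun x hx => (hf x hx).continuousAt.continuousWithinAt
  | succ n ih =>
    rw [Nat.cast_succ, contDiffOn_succ_iff_deriv_of_isOpen hI]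
    refine ⟨fun x hx => (hf x hx).differentiableAt.differentiableWithinAt, by simp, ?_⟩
    refine ((hV.of_le (by exact_mod_cast le_top)).comp ih hfU).congr fun x hx => ?_
    exact (hf x hx).deriv

/-! ### The equation off the critical set -/

section Flux

variable {F : Type*} [NormedAddCommGroup F] [InnerProductSpace ℝ F] {κ : ℝ} {z p q : F}

/-- The flux `u' - 2κ⟨u, u'⟩u` of the equation at `z = u`, `p = u'`: its divergence form is
`flux' + force = 0`. -/
noncomputable def flux (κ : ℝ) (z p : F) : F := p - (2 * κ * ⟪z, p⟫_ℝ) • z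

/-- The inverse of `flux κ z`; it breaks down, by a division by zero, at `2κ|z|² = 1`. -/
noncomputable def fluxInv (κ : ℝ) (z q : F) : F :=
  q + (2 * κ * ⟪z, q⟫_ℝ / (1 - 2 * κ * ‖z‖ ^ 2)) • z

theorem fluxInv_flux (h : 1 - 2 * κ * ‖z‖ ^ 2 ≠ 0) : fluxInv κ z (flux κ z p) = p := by
  have hinner : ⟪z, flux κ z p⟫_ℝ = (1 - 2 * κ * ‖z‖ ^ 2) * ⟪z, p⟫_ℝ := by
    rw [flux, inner_sub_right, real_inner_smul_right, real_inner_self_eq_norm_sq]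
    ring
  rw [fluxInv, hinner, mul_left_comm, mul_div_cancel_left₀ _ h, flux, sub_add_cancel]

theorem flux_fluxInv (h : 1 - 2 * κ * ‖z‖ ^ 2 ≠ 0) : flux κ z (fluxInv κ z q) = q := by
  have hcoeff : 2 * κ * ⟪z, q⟫_ℝ / (1 - 2 * κ * ‖z‖ ^ 2) = 2 * κ * ⟪z, fluxInv κ z q⟫_ℝ := by
    rw [fluxInv, inner_add_right, real_inner_smul_right, real_inner_self_eq_norm_sq]
    field_simp
    ring
  rw [flux, ← hcoeff, fluxInv, add_sub_cancel_right]

theorem hasDerivAt_flux {v g : ℝ → F} {v' g' : F} {x : ℝ} (hv : HasDerivAt v v' x)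
    (hg : HasDerivAt g g' x) :
    HasDerivAt (fun x => flux κ (v x) (g x))
      (g' - ((2 * κ * (⟪v x, g'⟫_ℝ + ⟪v', g x⟫_ℝ)) • v x + (2 * κ * ⟪v x, g x⟫_ℝ) • v')) x := by
  rw [add_comm (_ • v x)]
  exact hg.sub (((HasDerivAt.inner ℝ hv hg).const_mul (2 * κ)).smul hv)

theorem contDiffOn_fluxInv {n : WithTop ℕ∞} :
    ContDiffOn ℝ n (fun y : F × F => fluxInv κ y.1 y.2) {y | 1 - 2 * κ * ‖y.1‖ ^ 2 ≠ 0} := by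
  have hinner : ContDiff ℝ n fun y : F × F => 2 * κ * ⟪y.1, y.2⟫_ℝ :=
    contDiff_const.mul (contDiff_fst.inner ℝ contDiff_snd)
  have hdenom : ContDiff ℝ n fun y : F × F => 1 - 2 * κ * ‖y.1‖ ^ 2 :=
    contDiff_const.sub (contDiff_const.mul (contDiff_fst.norm_sq ℝ))
  exact contDiff_snd.contDiffOn.add
    ((hinner.contDiffOn.div hdenom.contDiffOn fun y hy => hy).smul contDiff_fst.contDiffOn)

theorem locallyIntegrable_inner_smul {v g h : ℝ → F} (hv : Continuous v)
    (hg : AEStronglyMeasurable g) (hh : AEStronglyMeasurable h)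
    (hgh : LocallyIntegrable (fun x => ‖g x‖ * ‖h x‖)) :
    LocallyIntegrable (fun x => ⟪v x, g x⟫_ℝ • h x) := by
  refine (hgh.continuous_mul hv.norm).mono
    ((hv.aestronglyMeasurable.inner hg).smul hh) (ae_of_all _ fun x => ?_)
  simp only [norm_smul, norm_mul, norm_norm, ← mul_assoc]
  gcongr
  exact norm_inner_le_norm _ _

end Flux

section WeakSolution

variable {c κ : ℝ} {v g : ℝ → ℂ}

/-- The terms `icu' + u(1 - |u|²) + 2κ⟨u, u'⟩u'` of the weak equation at `z = u`, `p = u'` that are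
tested against `φ` itself. -/
noncomputable def force (c κ : ℝ) (z p : ℂ) : ℂ :=
  Complex.I * c * p + (1 - ‖z‖ ^ 2) • z + (2 * κ * ⟪z, p⟫_ℝ) • p

theorem weak_integrand_eq (z p q q' : ℂ) :
    inner ℝ (Complex.I * (c : ℂ) * p + z * ((1 - ‖z‖ ^ 2 : ℝ) : ℂ)) q - inner ℝ p q'
      + 2 * κ * inner ℝ z p * (inner ℝ p q + inner ℝ z q')
      = ⟪force c κ z p, q⟫_ℝ - ⟪flux κ z p, q'⟫_ℝ := by
  rw [mul_comm z, ← Complex.real_smul]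
  simp only [force, flux, inner_add_left, inner_sub_left, real_inner_smul_left]
  ring

theorem locallyIntegrable_flux (hv : Continuous v) (hg : LocallyIntegrable g) :
    LocallyIntegrable (fun x => flux κ (v x) (g x)) := by
  have hgnorm : LocallyIntegrable fun x => ‖g x‖ := fun x =>
    let ⟨s, hs, hgs⟩ := hg x; ⟨s, hs, hgs.norm⟩
  have hinner : LocallyIntegrable fun x => ⟪v x, g x⟫_ℝ • v x :=
    locallyIntegrable_inner_smul hv hg.aestronglyMeasurable hv.aestronglyMeasurable
      (hgnorm.mul_continuous hv.norm)
  simp only [flux, mul_smul _ _ (v _)]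
  exact hg.sub (hinner.smul (2 * κ))

theorem locallyIntegrable_force (hv : Continuous v) (hg : MemLp g 2) :
    LocallyIntegrable (fun x => force c κ (v x) (g x)) := by
  have hgnorm : LocallyIntegrable fun x => ‖g x‖ * ‖g x‖ := by
    simpa only [← sq] using (hg.integrable_norm_pow two_ne_zero).locallyIntegrable
  have hinner : LocallyIntegrable fun x => ⟪v x, g x⟫_ℝ • g x :=
    locallyIntegrable_inner_smul hv hg.aestronglyMeasurable hg.aestronglyMeasurable hgnorm
  have hlinear : LocallyIntegrable fun x => Complex.I * c * g x :=
    (hg.locallyIntegrable one_le_two).continuous_mul continuous_const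
  have hpotential : Continuous fun x => (1 - ‖v x‖ ^ 2) • v x := by fun_prop
  simp only [force, mul_smul (2 * κ)]
  exact (hlinear.add hpotential.locallyIntegrable).add (hinner.smul (2 * κ))

theorem hasWeakDeriv_flux (hv : Continuous v) (hg : MemLp g 2)
    (hweak : ∀ φ : ℝ → ℂ, ContDiff ℝ ∞ φ → HasCompactSupport φ →
      ∫ x, (⟪force c κ (v x) (g x), φ x⟫_ℝ - ⟪flux κ (v x) (g x), deriv φ x⟫_ℝ) = 0) :
    HasWeakDeriv (fun x => flux κ (v x) (g x)) (fun x => -force c κ (v x) (g x)) := by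
  have hflux : LocallyIntegrable (fun x => flux κ (v x) (g x)) :=
    locallyIntegrable_flux hv (hg.locallyIntegrable (by norm_num))
  have hforce : LocallyIntegrable (fun x => force c κ (v x) (g x)) :=
    locallyIntegrable_force hv hg
  refine ⟨hflux, hforce.neg, fun φ hφ hsupp => ?_⟩
  have hφforce := hforce.integrable_smul_left_of_hasCompactSupport hφ.continuous hsupp
  have hφflux := hflux.integrable_smul_left_of_hasCompactSupport
    (hφ.continuous_deriv (by simp)) hsupp.deriv
  simp only [smul_neg, integral_neg, neg_neg]
  refine (sub_eq_zero.1 ((integral_sub hφforce hφflux).symm.trans ?_)).symm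
  refine ext_inner_left ℝ fun z => ?_
  have hderiv : ∀ x, deriv (fun x => φ x • z) x = deriv φ x • z := fun x =>
    (((hφ.differentiable (by simp)) x).hasDerivAt.smul_const z).deriv
  rw [inner_zero_right, ← integral_inner (f := fun x => φ x • force c κ (v x) (g x)
    - deriv φ x • flux κ (v x) (g x)) (hφforce.sub hφflux),
    ← hweak (fun x => φ x • z) (hφ.smul contDiff_const) hsupp.smul_right]
  simp only [hderiv, real_inner_smul_right, inner_sub_right, real_inner_comm z]

/-- `v` is the continuous representative of a finite energy weak solution and `g` is its weak
derivative; the equation is in divergence form. -/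
structure IsFiniteEnergySolution (c κ : ℝ) (v g : ℝ → ℂ) : Prop where
  continuous : Continuous v
  memLp_deriv : MemLp g 2
  memLp_intensity : MemLp (intensity v) 2
  hasWeakDeriv : HasWeakDeriv v g
  hasWeakDeriv_flux :
    HasWeakDeriv (fun x => flux κ (v x) (g x)) (fun x => -force c κ (v x) (g x))

theorem exists_isFiniteEnergySolution {u : ℝ → ℂ} (hu : u ∈ EnergySpace)
    (hsol : IsWeakSolution c κ u) :
    ∃ v g, v =ᵐ[volume] u ∧ IsFiniteEnergySolution c κ v g := by
  obtain ⟨-, ⟨g, hug, hg⟩, hη⟩ := hu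
  obtain ⟨g', hug', hweak⟩ := hsol
  obtain ⟨v, hv, hvu, hvg⟩ := hug.exists_continuous
  refine ⟨v, g, hvu, hv, hg, (memLp_congr_ae ?_).1 hη, hvg,
    hasWeakDeriv_flux hv hg fun φ hφ hsupp => ?_⟩
  · filter_upwards [hvu] with x hx
    rw [intensity, hx]
  · rw [← hweak φ hφ hsupp]
    refine integral_congr_ae ?_
    filter_upwards [hvu, hug.unique hug'] with x hvx hgx
    rw [weak_integrand_eq, hvx, hgx]

theorem contDiff_force {n : WithTop ℕ∞} :
    ContDiff ℝ n fun y : ℂ × ℂ => force c κ y.1 y.2 := by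
  have hinner : ContDiff ℝ n fun y : ℂ × ℂ => 2 * κ * ⟪y.1, y.2⟫_ℝ :=
    contDiff_const.mul (contDiff_fst.inner ℝ contDiff_snd)
  have hnorm : ContDiff ℝ n fun y : ℂ × ℂ => 1 - ‖y.1‖ ^ 2 :=
    contDiff_const.sub (contDiff_fst.norm_sq ℝ)
  exact ((contDiff_const.mul contDiff_snd).add (hnorm.smul contDiff_fst)).add
    (hinner.smul contDiff_snd)

/-- The right-hand side of the equation as a first-order autonomous system for `u` and its flux. -/
noncomputable def fluxSystem (c κ : ℝ) (y : ℂ × ℂ) : ℂ × ℂ :=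
  (fluxInv κ y.1 y.2, -force c κ y.1 (fluxInv κ y.1 y.2))

theorem contDiffOn_fluxSystem {n : WithTop ℕ∞} :
    ContDiffOn ℝ n (fluxSystem c κ) {y | 1 - 2 * κ * ‖y.1‖ ^ 2 ≠ 0} := by
  have hinv : ContDiffOn ℝ n (fun y : ℂ × ℂ => fluxInv κ y.1 y.2) _ := contDiffOn_fluxInv (κ := κ)
  exact hinv.prodMk (contDiff_force.comp_contDiffOn (contDiff_fst.contDiffOn.prodMk hinv)).neg

theorem one_sub_ne_zero_of_notMem_criticalSet {x : ℝ} (hx : x ∉ criticalSet κ v) :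
    1 - 2 * κ * ‖v x‖ ^ 2 ≠ 0 := fun h => hx <| by
  have hκ : 2 * κ ≠ 0 := fun h0 => by simp [h0] at h
  exact (eq_div_iff hκ).2 (by linarith)

theorem isClosed_criticalSet (hv : Continuous v) : IsClosed (criticalSet κ v) :=
  isClosed_eq (hv.norm.pow 2) continuous_const

/-- `v` is smooth on `I` and solves the travelling wave equation there, with `(1 - |v|²)''`
written out in terms of `v`. -/
structure IsClassicalSolutionOn (c κ : ℝ) (v : ℝ → ℂ) (I : Set ℝ) : Prop where
  contDiffOn : ContDiffOn ℝ ∞ v I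
  eqn : ∀ x ∈ I, deriv (deriv v) x = (2 * κ * (⟪v x, deriv (deriv v) x⟫_ℝ + ‖deriv v x‖ ^ 2)) • v x
    - Complex.I * c * deriv v x - intensity v x • v x

namespace IsFiniteEnergySolution

theorem exists_hasDerivAt_fluxSystem (h : IsFiniteEnergySolution c κ v g) :
    ∃ w : ℝ → ℂ, (fun x => flux κ (v x) (g x)) =ᵐ[volume] w ∧
      ∀ x ∉ criticalSet κ v, HasDerivAt v (fluxSystem c κ (v x, w x)).1 x ∧
        HasDerivAt w (fluxSystem c κ (v x, w x)).2 x := by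
  obtain ⟨w, hw, hwflux, hwforce⟩ := h.hasWeakDeriv_flux.exists_continuous
  have hopen : IsOpen (criticalSet κ v)ᶜ := (isClosed_criticalSet h.continuous).isOpen_compl
  have hgp : ∀ᵐ x, x ∈ (criticalSet κ v)ᶜ → g x = fluxInv κ (v x) (w x) := by
    filter_upwards [hwflux] with x hx hxI
    rw [hx, fluxInv_flux (one_sub_ne_zero_of_notMem_criticalSet hxI)]
  have hsystem : ContinuousOn (fun x => fluxSystem c κ (v x, w x)) (criticalSet κ v)ᶜ :=
    (contDiffOn_fluxSystem (n := 0)).continuousOn.comp (h.continuous.prodMk hw).continuousOn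
      fun x hx => one_sub_ne_zero_of_notMem_criticalSet hx
  refine ⟨w, hwflux.symm, fun x hx => ⟨?_, ?_⟩⟩
  · exact h.hasWeakDeriv.hasDerivAt h.continuous hopen hgp hsystem.fst hx
  · exact hwforce.hasDerivAt hw hopen (hgp.mono fun y hy hyI => by rw [hy hyI]; rfl) hsystem.snd hx

theorem ae_eq_deriv (h : IsFiniteEnergySolution c κ v g) :
    ∀ᵐ x, x ∉ criticalSet κ v → g x = deriv v x := by
  obtain ⟨w, hwflux, hvw⟩ := h.exists_hasDerivAt_fluxSystem
  filter_upwards [hwflux] with x hx hxI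
  rw [(hvw x hxI).1.deriv, fluxSystem, ← hx,
    fluxInv_flux (one_sub_ne_zero_of_notMem_criticalSet hxI)]

theorem isClassicalSolutionOn (h : IsFiniteEnergySolution c κ v g) :
    IsClassicalSolutionOn c κ v (criticalSet κ v)ᶜ := by
  obtain ⟨w, -, hvw⟩ := h.exists_hasDerivAt_fluxSystem
  have hopen : IsOpen (criticalSet κ v)ᶜ := (isClosed_criticalSet h.continuous).isOpen_compl
  have hsmooth : ContDiffOn ℝ ∞ v (criticalSet κ v)ᶜ :=
    (contDiffOn_of_hasDerivAt_comp hopen contDiffOn_fluxSystem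
      (fun x hx => one_sub_ne_zero_of_notMem_criticalSet hx)
      fun x hx => (hvw x hx).1.prodMk (hvw x hx).2).fst
  refine ⟨hsmooth, fun x hx => ?_⟩
  have hdiff : DifferentiableAt ℝ (deriv v) x :=
    ((hsmooth.contDiffAt (hopen.mem_nhds hx)).derivWithin (m := ∞) le_rfl).differentiableAt
      (by simp)
  have hderiv : ∀ y ∉ criticalSet κ v, deriv v y = fluxInv κ (v y) (w y) := fun y hy =>
    (hvw y hy).1.deriv
  have hflux : (fun y => flux κ (v y) (deriv v y)) =ᶠ[𝓝 x] w := by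
    filter_upwards [hopen.mem_nhds hx] with y hy
    rw [hderiv y hy, flux_fluxInv (one_sub_ne_zero_of_notMem_criticalSet hy)]
  have hforce : HasDerivAt w (-force c κ (v x) (deriv v x)) x := by
    rw [hderiv x hx]
    exact (hvw x hx).2
  have heqn := (((hasDerivAt_flux (κ := κ) (hvw x hx).1.differentiableAt.hasDerivAt
    hdiff.hasDerivAt).congr_of_eventuallyEq hflux.symm).unique hforce)
  rw [force, real_inner_self_eq_norm_sq, ← intensity] at heqn
  linear_combination (norm := module) heqn

end IsFiniteEnergySolution
end WeakSolution

/-! ### First integrals -/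

theorem exists_seq_tendsto_zero_of_integrableOn {X E : Type*} [MeasurableSpace X]
    [NormedAddCommGroup E] {μ : Measure X} {f : X → E} {s : Set X} (hs : MeasurableSet s)
    (hμs : μ s = ⊤) (hf : IntegrableOn f s μ) :
    ∃ x : ℕ → X, (∀ n, x n ∈ s) ∧ Tendsto (fun n => f (x n)) atTop (𝓝 0) := by
  have exists_norm_lt : ∀ ε : ℝ, 0 < ε → ∃ x ∈ s, ‖f x‖ < ε := by
    by_contra! ⟨ε, hε, hle⟩
    have hlt := hf.measure_norm_ge_lt_top hε
    rw [Measure.restrict_apply' hs, inter_eq_right.2 (show s ⊆ {x | ε ≤ ‖f x‖} from hle),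
      hμs] at hlt
    exact hlt.false
  choose x hxs hx using fun n : ℕ => exists_norm_lt (1 / (n + 1)) Nat.one_div_pos_of_nat
  exact ⟨x, hxs, squeeze_zero_norm (fun n => (hx n).le) tendsto_one_div_add_atTop_nhds_zero_nat⟩

theorem eq_zero_of_hasDerivAt_zero_of_tendsto {f : ℝ → ℝ} {I : Set ℝ} (hI : IsOpen I)
    (hI' : IsPreconnected I) (hf : ∀ x ∈ I, HasDerivAt f 0 x) {t : ℕ → ℝ} (ht : ∀ n, t n ∈ I)
    (hlim : Tendsto (fun n => f (t n)) atTop (𝓝 0)) : ∀ x ∈ I, f x = 0 := fun x hx => by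
  have hconst : ∀ n, f (t n) = f x := fun n => hI.is_const_of_deriv_eq_zero hI'
    (fun y hy => (hf y hy).differentiableAt.differentiableWithinAt)
    (fun y hy => (hf y hy).deriv) (ht n) hx
  exact tendsto_nhds_unique (by simp only [hconst, tendsto_const_nhds]) hlim

section FirstIntegrals

variable {c κ : ℝ} {v g : ℝ → ℂ} {I : Set ℝ} {x : ℝ}

theorem inner_I_mul_self (z : ℂ) : ⟪Complex.I * z, z⟫_ℝ = 0 := by
  simp [Complex.inner, Complex.mul_re]
  ring

theorem inner_I_mul_inner_I_mul (z w : ℂ) : ⟪Complex.I * z, Complex.I * w⟫_ℝ = ⟪z, w⟫_ℝ := by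
  simp only [Complex.inner, map_mul, Complex.conj_I]
  rw [mul_mul_mul_comm, mul_neg, Complex.I_mul_I, neg_neg, one_mul]

theorem norm_sq_mul_norm_sq (z w : ℂ) :
    ‖z‖ ^ 2 * ‖w‖ ^ 2 = ⟪z, w⟫_ℝ ^ 2 + ⟪Complex.I * z, w⟫_ℝ ^ 2 := by
  simp [Complex.inner, Complex.sq_norm, Complex.normSq_apply]
  ring

theorem hasDerivAt_intensity {v' : ℂ} (hv : HasDerivAt v v' x) :
    HasDerivAt (intensity v) (-(2 * ⟪v x, v'⟫_ℝ)) x :=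
  hv.norm_sq.const_sub 1

namespace IsClassicalSolutionOn

theorem mono {J : Set ℝ} (h : IsClassicalSolutionOn c κ v I) (hJ : J ⊆ I) :
    IsClassicalSolutionOn c κ v J :=
  ⟨h.contDiffOn.mono hJ, fun x hx => h.eqn x (hJ hx)⟩

theorem hasDerivAt (h : IsClassicalSolutionOn c κ v I) (hx : I ∈ 𝓝 x) :
    HasDerivAt v (deriv v x) x :=
  ((h.contDiffOn.contDiffAt hx).differentiableAt (by simp)).hasDerivAt

theorem hasDerivAt_deriv (h : IsClassicalSolutionOn c κ v I) (hx : I ∈ 𝓝 x) :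
    HasDerivAt (deriv v) (deriv (deriv v) x) x :=
  (((h.contDiffOn.contDiffAt hx).derivWithin (m := ∞) le_rfl).differentiableAt
    (by simp)).hasDerivAt

theorem inner_eqn (h : IsClassicalSolutionOn c κ v I) (hx : x ∈ I) (q : ℂ) :
    ⟪deriv (deriv v) x, q⟫_ℝ
      = 2 * κ * (⟪v x, deriv (deriv v) x⟫_ℝ + ‖deriv v x‖ ^ 2) * ⟪v x, q⟫_ℝ
        - c * ⟪Complex.I * deriv v x, q⟫_ℝ - intensity v x * ⟪v x, q⟫_ℝ := by
  have hsmul : Complex.I * c * deriv v x = c • (Complex.I * deriv v x) := by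
    rw [Complex.real_smul]
    ring
  conv_lhs => rw [h.eqn x hx, hsmul]
  simp only [inner_sub_left, real_inner_smul_left]

theorem hasDerivAt_momentum (h : IsClassicalSolutionOn c κ v I) (hx : I ∈ 𝓝 x) :
    HasDerivAt (fun x => ⟪Complex.I * v x, deriv v x⟫_ℝ - c / 2 * intensity v x) 0 x := by
  convert! (HasDerivAt.inner ℝ ((h.hasDerivAt hx).const_mul Complex.I)
    (h.hasDerivAt_deriv hx)).sub
      ((hasDerivAt_intensity (h.hasDerivAt hx)).const_mul (c / 2)) using 1
  have heqn := h.inner_eqn (mem_of_mem_nhds hx) (Complex.I * v x)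
  rw [real_inner_comm (Complex.I * v x) (v x), inner_I_mul_self, inner_I_mul_inner_I_mul] at heqn
  rw [inner_I_mul_self, real_inner_comm (deriv (deriv v) x), heqn, real_inner_comm (v x)]
  ring

theorem hasDerivAt_energy (h : IsClassicalSolutionOn c κ v I) (hx : I ∈ 𝓝 x) :
    HasDerivAt
      (fun x => ‖deriv v x‖ ^ 2 - 2 * κ * ⟪v x, deriv v x⟫_ℝ ^ 2 - intensity v x ^ 2 / 2) 0 x := by
  have hv := h.hasDerivAt hx
  have hp := h.hasDerivAt_deriv hx
  convert! (hp.norm_sq.sub (((HasDerivAt.inner ℝ hv hp).pow 2).const_mul (2 * κ))).sub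
    (((hasDerivAt_intensity hv).pow 2).div_const 2) using 1
  have heqn := h.inner_eqn (mem_of_mem_nhds hx) (deriv v x)
  rw [inner_I_mul_self] at heqn
  rw [real_inner_self_eq_norm_sq, real_inner_comm (deriv (deriv v) x), heqn]
  ring

end IsClassicalSolutionOn

/-- `v` is smooth on `I` and satisfies there the two conservation laws of the travelling wave
equation, with the integration constants that belong to `|v| → 1`, `v' → 0` at infinity. -/
structure HasFirstIntegralsOn (c κ : ℝ) (v : ℝ → ℂ) (I : Set ℝ) : Prop where
  contDiffOn : ContDiffOn ℝ ∞ v I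
  momentum : ∀ x ∈ I, ⟪Complex.I * v x, deriv v x⟫_ℝ = c / 2 * intensity v x
  energy : ∀ x ∈ I, 2 * ‖deriv v x‖ ^ 2 = 4 * κ * ⟪v x, deriv v x⟫_ℝ ^ 2 + intensity v x ^ 2

theorem IsClassicalSolutionOn.hasFirstIntegralsOn (h : IsClassicalSolutionOn c κ v I)
    (hI : IsOpen I) (hI' : IsPreconnected I) (hvol : volume I = ⊤)
    (henergy : IntegrableOn (fun x => ‖deriv v x‖ ^ 2 + intensity v x ^ 2) I) :
    HasFirstIntegralsOn c κ v I := by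
  obtain ⟨t, ht, hlim⟩ := exists_seq_tendsto_zero_of_integrableOn hI.measurableSet hvol henergy
  have hp : Tendsto (fun n => ‖deriv v (t n)‖) atTop (𝓝 0) := by
    simpa using (squeeze_zero (fun n => sq_nonneg _)
      (fun n => le_add_of_nonneg_right (sq_nonneg _)) hlim).sqrt
  have hη : Tendsto (fun n => intensity v (t n)) atTop (𝓝 0) := by
    refine (tendsto_zero_iff_abs_tendsto_zero _).2 ?_
    simpa [Function.comp_def, Real.sqrt_sq_eq_abs] using (squeeze_zero (fun n => sq_nonneg _)
      (fun n => le_add_of_nonneg_left (sq_nonneg _)) hlim).sqrt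
  have hv : Tendsto (fun n => ‖v (t n)‖) atTop (𝓝 1) := by
    simpa [intensity] using (hη.const_sub 1).sqrt
  have hvp : Tendsto (fun n => ‖v (t n)‖ * ‖deriv v (t n)‖) atTop (𝓝 0) := by
    simpa only [mul_zero] using hv.mul hp
  have hdot : Tendsto (fun n => ⟪v (t n), deriv v (t n)⟫_ℝ) atTop (𝓝 0) :=
    squeeze_zero_norm (fun n => norm_inner_le_norm _ _) hvp
  have hcross : Tendsto (fun n => ⟪Complex.I * v (t n), deriv v (t n)⟫_ℝ) atTop (𝓝 0) :=
    squeeze_zero_norm (fun n => (norm_inner_le_norm _ _).trans_eq (by simp)) hvp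
  have hmomentum := hcross.sub (hη.const_mul (c / 2))
  have henergy := ((hp.pow 2).sub ((hdot.pow 2).const_mul (2 * κ))).sub ((hη.pow 2).div_const 2)
  rw [mul_zero, sub_zero] at hmomentum
  rw [zero_pow two_ne_zero, mul_zero, zero_div, sub_zero, sub_zero] at henergy
  refine ⟨h.contDiffOn, fun x hx => ?_, fun x hx => ?_⟩
  · linarith [eq_zero_of_hasDerivAt_zero_of_tendsto hI hI'
      (fun y hy => h.hasDerivAt_momentum (hI.mem_nhds hy)) ht hmomentum x hx]
  · linarith [eq_zero_of_hasDerivAt_zero_of_tendsto hI hI'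
      (fun y hy => h.hasDerivAt_energy (hI.mem_nhds hy)) ht henergy x hx]

theorem IsFiniteEnergySolution.hasFirstIntegralsOn (h : IsFiniteEnergySolution c κ v g)
    (hI : IsOpen I) (hI' : IsPreconnected I) (hvol : volume I = ⊤)
    (hcrit : I ⊆ (criticalSet κ v)ᶜ) : HasFirstIntegralsOn c κ v I := by
  refine (h.isClassicalSolutionOn.mono hcrit).hasFirstIntegralsOn hI hI' hvol ?_
  have hg : Integrable fun x => ‖g x‖ ^ 2 := h.memLp_deriv.integrable_norm_pow two_ne_zero
  refine (hg.add h.memLp_intensity.integrable_sq).integrableOn.congr_fun_ae ?_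
  refine (ae_restrict_iff' hI.measurableSet).2 (h.ae_eq_deriv.mono fun x hx hxI => ?_)
  simp only [Pi.add_apply, hx (hcrit hxI)]

namespace HasFirstIntegralsOn

theorem union {J : Set ℝ} (h : HasFirstIntegralsOn c κ v I) (h' : HasFirstIntegralsOn c κ v J)
    (hI : IsOpen I) (hJ : IsOpen J) : HasFirstIntegralsOn c κ v (I ∪ J) where
  contDiffOn := h.contDiffOn.union_of_isOpen h'.contDiffOn hI hJ
  momentum x hx := hx.elim (h.momentum x) (h'.momentum x)
  energy x hx := hx.elim (h.energy x) (h'.energy x)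

theorem hasDerivAt (h : HasFirstIntegralsOn c κ v I) (hx : I ∈ 𝓝 x) :
    HasDerivAt v (deriv v x) x :=
  ((h.contDiffOn.contDiffAt hx).differentiableAt (by simp)).hasDerivAt

theorem hasDerivAt_intensity (h : HasFirstIntegralsOn c κ v I) (hx : I ∈ 𝓝 x) :
    HasDerivAt (intensity v) (-(2 * ⟪v x, deriv v x⟫_ℝ)) x :=
  Cuspon.hasDerivAt_intensity (h.hasDerivAt hx)

theorem intensity_eqn (h : HasFirstIntegralsOn c κ v I) (hx : I ∈ 𝓝 x) :
    (1 - 2 * κ + 2 * κ * intensity v x) * deriv (intensity v) x ^ 2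
      = intensity v x ^ 2 * (2 - c ^ 2 - 2 * intensity v x) := by
  have hnorm := norm_sq_mul_norm_sq (v x) (deriv v x)
  rw [h.momentum x (mem_of_mem_nhds hx),
    show ‖v x‖ ^ 2 = 1 - intensity v x by rw [intensity]; ring] at hnorm
  rw [(h.hasDerivAt_intensity hx).deriv]
  linear_combination 2 * (1 - intensity v x) * h.energy x (mem_of_mem_nhds hx) - 4 * hnorm

end HasFirstIntegralsOn

theorem exists_phase_hasDerivAt (hI : IsOpen I) (hI' : IsPreconnected I)
    (hv : ContDiffOn ℝ 1 v I) (hne : ∀ x ∈ I, v x ≠ 0) :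
    ∃ θ : ℝ → ℝ, ∀ x ∈ I, v x = ‖v x‖ * Complex.exp (Complex.I * θ x) ∧
      HasDerivAt θ (⟪Complex.I * v x, deriv v x⟫_ℝ / ‖v x‖ ^ 2) x := by
  obtain rfl | ⟨x₀, hx₀⟩ := I.eq_empty_or_nonempty
  · exact ⟨0, fun x hx => hx.elim⟩
  have hquot : ContinuousOn (fun x => deriv v x / v x) I :=
    (hv.continuousOn_deriv_of_isOpen hI le_rfl).div hv.continuousOn hne
  have hquot_int : ∀ x ∈ I, IntervalIntegrable (fun x => deriv v x / v x) volume x₀ x :=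
    fun x hx => (hquot.mono (hI'.ordConnected.uIcc_subset hx₀ hx)).intervalIntegrable
  set L : ℝ → ℂ := fun x => Complex.log (v x₀) + ∫ t in x₀..x, deriv v t / v t
  have hL : ∀ x ∈ I, HasDerivAt L (deriv v x / v x) x := fun x hx =>
    (intervalIntegral.integral_hasDerivAt_right (hquot_int x hx)
      (hquot.stronglyMeasurableAtFilter hI x hx) (hquot.continuousAt (hI.mem_nhds hx))).const_add _
  have hconst : ∀ x ∈ I, HasDerivAt (fun x => v x * Complex.exp (-L x)) 0 x := fun x hx => by
    have hvx : HasDerivAt v (deriv v x) x :=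
      ((hv.contDiffAt (hI.mem_nhds hx)).differentiableAt one_ne_zero).hasDerivAt
    convert! hvx.mul (hL x hx).neg.cexp using 1
    field_simp [hne x hx]
    ring
  have hexp : ∀ x ∈ I, v x = Complex.exp (L x) := fun x hx => by
    have heq := hI.is_const_of_deriv_eq_zero hI'
      (fun y hy => (hconst y hy).differentiableAt.differentiableWithinAt)
      (fun y hy => (hconst y hy).deriv) hx hx₀
    have hL₀ : L x₀ = Complex.log (v x₀) := by simp [L]
    rw [hL₀, Complex.exp_neg, Complex.exp_neg, Complex.exp_log (hne x₀ hx₀),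
      mul_inv_cancel₀ (hne x₀ hx₀), mul_inv_eq_one₀ (Complex.exp_ne_zero _)] at heq
    exact heq
  refine ⟨fun x => (L x).im, fun x hx => ⟨?_, ?_⟩⟩
  · rw [hexp x hx, Complex.norm_exp, Complex.ofReal_exp, ← Complex.exp_add, mul_comm Complex.I,
      Complex.re_add_im]
  · convert! Complex.imCLM.hasFDerivAt.comp_hasDerivAt x (hL x hx) using 1
    simp [Complex.div_im, Complex.inner, Complex.sq_norm, Complex.normSq_apply]
    ring

end FirstIntegrals

/-! ### Travel time -/

section TravelTime

variable {κ α r : ℝ}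

/-- The integral `∫_r^∞ 2 / (s² - α²) ds`, for `0 ≤ α < r`. -/
noncomputable def hyperbolicTime (α r : ℝ) : ℝ :=
  if α = 0 then 2 / r else 2 / α * Real.artanh (α / r)

/-- The integral `∫_r^∞ 2(1 + κα²) / ((1 + κs²)(s² - α²)) ds`: the position at which the slope
`-η'/η` of a cuspon with its cusp at `0` takes the value `r`. -/
noncomputable def travelTime (κ α r : ℝ) : ℝ :=
  2 * √κ * Real.arctan (√κ * r) + hyperbolicTime α r - Real.pi * √κ

theorem hyperbolicTime_zero (r : ℝ) : hyperbolicTime 0 r = 2 / r := if_pos rfl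

theorem hyperbolicTime_of_pos (hα : 0 < α) (hr : α < r) :
    hyperbolicTime α r = 1 / α * (Real.log (r + α) - Real.log (r - α)) := by
  have hr₀ : 0 < r := hα.trans hr
  have hsub : r - α ≠ 0 := (sub_pos.2 hr).ne'
  rw [hyperbolicTime, if_neg hα.ne', Real.artanh_eq_half_log
    ⟨by linarith [div_pos hα hr₀], ((div_lt_one hr₀).2 hr).le⟩, ← Real.log_div (by linarith) hsub,
    show (1 + α / r) / (1 - α / r) = (r + α) / (r - α) by field_simp]
  ring

theorem hasDerivAt_hyperbolicTime (hα : 0 ≤ α) (hr : α < r) :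
    HasDerivAt (hyperbolicTime α) (-(2 / (r ^ 2 - α ^ 2))) r := by
  obtain rfl | hα := hα.eq_or_lt
  · rw [funext hyperbolicTime_zero]
    convert! (hasDerivAt_inv hr.ne').const_mul 2 using 1
    field_simp
    ring
  · have hadd : r + α ≠ 0 := by linarith
    have hsub : r - α ≠ 0 := (sub_pos.2 hr).ne'
    have hlog : HasDerivAt (fun r => 1 / α * (Real.log (r + α) - Real.log (r - α)))
        (1 / α * (1 / (r + α) - 1 / (r - α))) r :=
      ((((hasDerivAt_id r).add_const α).log hadd).sub
        (((hasDerivAt_id r).sub_const α).log hsub)).const_mul (1 / α)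
    convert! hlog.congr_of_eventuallyEq ?_ using 1
    · rw [show r ^ 2 - α ^ 2 = (r + α) * (r - α) by ring]
      field_simp
      ring
    · filter_upwards [Ioi_mem_nhds hr] with s hs using hyperbolicTime_of_pos hα hs

theorem tendsto_hyperbolicTime_atTop (hα : 0 ≤ α) :
    Tendsto (hyperbolicTime α) atTop (𝓝 0) := by
  obtain rfl | hα := hα.eq_or_lt
  · rw [funext hyperbolicTime_zero]
    exact tendsto_const_nhds.div_atTop tendsto_id
  · have hratio : Tendsto (fun r => 1 + 2 * α / (r - α)) atTop (𝓝 (1 + 0)) :=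
      (tendsto_const_nhds.div_atTop (tendsto_atTop_add_const_right _ (-α) tendsto_id)).const_add 1
    have hlog := (hratio.log (by norm_num)).const_mul (1 / α)
    rw [add_zero, Real.log_one, mul_zero] at hlog
    refine hlog.congr' ?_
    filter_upwards [eventually_gt_atTop α] with r hr
    have hsub : r - α ≠ 0 := (sub_pos.2 hr).ne'
    rw [hyperbolicTime_of_pos hα hr, ← Real.log_div (by linarith) hsub,
      show 1 + 2 * α / (r - α) = (r + α) / (r - α) by field_simp; ring]

theorem tendsto_hyperbolicTime_nhdsGT (hα : 0 ≤ α) :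
    Tendsto (hyperbolicTime α) (𝓝[>] α) atTop := by
  obtain rfl | hα := hα.eq_or_lt
  · rw [funext hyperbolicTime_zero]
    exact tendsto_inv_nhdsGT_zero.const_mul_atTop two_pos
  · have hsub : Tendsto (fun r => r - α) (𝓝[>] α) (𝓝[>] 0) := by
      refine tendsto_nhdsWithin_iff.2 ⟨?_, ?_⟩
      · exact tendsto_sub_nhds_zero_iff.2 (tendsto_id.mono_left nhdsWithin_le_nhds)
      · filter_upwards [self_mem_nhdsWithin] with r hr using sub_pos.2 (mem_Ioi.1 hr)
    have hlog_sub : Tendsto (fun r => -Real.log (r - α)) (𝓝[>] α) atTop :=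
      tendsto_neg_atBot_atTop.comp (Real.tendsto_log_nhdsGT_zero.comp hsub)
    have hlog_add : Tendsto (fun r => Real.log (r + α)) (𝓝[>] α) (𝓝 (Real.log (α + α))) :=
      ((tendsto_id.mono_left nhdsWithin_le_nhds).add_const α).log (add_pos hα hα).ne'
    refine ((hlog_add.add_atTop hlog_sub).const_mul_atTop (one_div_pos.2 hα)).congr' ?_
    filter_upwards [self_mem_nhdsWithin] with r hr
    rw [hyperbolicTime_of_pos hα hr]
    ring

theorem continuous_arctan_sqrt_mul (κ : ℝ) :
    Continuous fun r => 2 * √κ * Real.arctan (√κ * r) :=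
  (Real.continuous_arctan.comp (continuous_const_mul _)).const_mul _

theorem hasDerivAt_travelTime (hκ : 0 < κ) (hα : 0 ≤ α) (hr : α < r) :
    HasDerivAt (travelTime κ α)
      (-(2 * (1 + κ * α ^ 2) / ((1 + κ * r ^ 2) * (r ^ 2 - α ^ 2)))) r := by
  have hsub : 0 < r ^ 2 - α ^ 2 := sub_pos.2 (pow_lt_pow_left₀ hr hα two_ne_zero)
  have harctan : HasDerivAt (fun r => 2 * √κ * Real.arctan (√κ * r))
      (2 * κ / (1 + κ * r ^ 2)) r := by
    convert! (((hasDerivAt_id r).const_mul (√κ)).arctan).const_mul (2 * √κ) using 1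
    simp only [id, mul_pow, Real.sq_sqrt hκ.le]
    linear_combination (-2 / (1 + κ * r ^ 2)) * Real.sq_sqrt hκ.le
  convert! (harctan.add (hasDerivAt_hyperbolicTime hα hr)).sub_const (Real.pi * √κ) using 1
  field_simp
  ring

theorem strictAntiOn_travelTime (hκ : 0 < κ) (hα : 0 ≤ α) :
    StrictAntiOn (travelTime κ α) (Ioi α) := by
  refine strictAntiOn_of_deriv_neg (convex_Ioi α) (fun r hr =>
    (hasDerivAt_travelTime hκ hα hr).continuousAt.continuousWithinAt) fun r hr => ?_
  rw [interior_Ioi] at hr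
  have hsub : 0 < r ^ 2 - α ^ 2 := sub_pos.2 (pow_lt_pow_left₀ hr hα two_ne_zero)
  rw [(hasDerivAt_travelTime hκ hα hr).deriv, neg_lt_zero]
  positivity

theorem tendsto_travelTime_atTop (hκ : 0 < κ) (hα : 0 ≤ α) :
    Tendsto (travelTime κ α) atTop (𝓝 0) := by
  have harctan : Tendsto (fun r => 2 * √κ * Real.arctan (√κ * r)) atTop
      (𝓝 (2 * √κ * (Real.pi / 2))) :=
    ((Real.tendsto_arctan_atTop.mono_right nhdsWithin_le_nhds).comp
      (tendsto_id.const_mul_atTop (Real.sqrt_pos.2 hκ))).const_mul _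
  convert! (harctan.add (tendsto_hyperbolicTime_atTop hα)).sub_const (Real.pi * √κ) using 2
  ring

theorem tendsto_travelTime_nhdsGT (hα : 0 ≤ α) : Tendsto (travelTime κ α) (𝓝[>] α) atTop :=
  tendsto_atTop_add_const_right _ _ ((((continuous_arctan_sqrt_mul κ).tendsto α).mono_left
    nhdsWithin_le_nhds).add_atTop (tendsto_hyperbolicTime_nhdsGT hα))

theorem travelTime_pos (hκ : 0 < κ) (hα : 0 ≤ α) (hr : α < r) : 0 < travelTime κ α r := by
  have hanti := strictAntiOn_travelTime hκ hα
  have hr' : r + 1 ∈ Ioi α := hr.trans (lt_add_one r)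
  refine lt_of_le_of_lt (le_of_tendsto (tendsto_travelTime_atTop hκ hα) ?_)
    (hanti hr hr' (lt_add_one r))
  filter_upwards [eventually_gt_atTop (r + 1)] with s hs
  exact (hanti hr' (mem_Ioi.2 (hr'.trans hs)) hs).le

end TravelTime

/-! ### Normal profiles -/

section Slope

variable {κ α ξ : ℝ}

/-- The slope `-ξ'/ξ` of a normalised profile as a function of its value `ξ`. -/
noncomputable def slope (κ α ξ : ℝ) : ℝ := √((α ^ 2 + 2 * ξ) / (1 - 2 * κ * ξ))

theorem slope_sq (hξ : 0 ≤ ξ) (hsub : 0 < 1 - 2 * κ * ξ) :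
    slope κ α ξ ^ 2 = (α ^ 2 + 2 * ξ) / (1 - 2 * κ * ξ) :=
  Real.sq_sqrt (by positivity)

theorem lt_slope (hκ : 0 < κ) (hα : 0 ≤ α) (hξ : 0 < ξ) (hsub : 0 < 1 - 2 * κ * ξ) :
    α < slope κ α ξ := by
  rw [slope, Real.lt_sqrt hα, lt_div_iff₀ hsub]
  have : 0 < κ * ξ * α ^ 2 + ξ := by positivity
  nlinarith

theorem one_sub_eq_slope (hκ : 0 < κ) (hξ : 0 ≤ ξ) (hsub : 0 < 1 - 2 * κ * ξ) :
    1 - 2 * κ * ξ = (1 + κ * α ^ 2) / (1 + κ * slope κ α ξ ^ 2) := by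
  have hadd : 0 < 1 + κ * slope κ α ξ ^ 2 := by positivity
  rw [eq_div_iff hadd.ne', slope_sq hξ hsub]
  field_simp
  ring

theorem eq_slope (hκ : 0 < κ) (hξ : 0 ≤ ξ) (hsub : 0 < 1 - 2 * κ * ξ) :
    ξ = (slope κ α ξ ^ 2 - α ^ 2) / (2 * (1 + κ * slope κ α ξ ^ 2)) := by
  have hadd : 0 < 1 + κ * slope κ α ξ ^ 2 := by positivity
  have hone_sub := one_sub_eq_slope (α := α) hκ hξ hsub
  rw [eq_div_iff hadd.ne'] at hone_sub
  rw [eq_div_iff (by positivity)]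
  refine mul_left_cancel₀ hκ.ne' ?_
  linear_combination -hone_sub

end Slope

/-- The position at which a normalised profile takes the value `ξ`, in `(0, 1/(2κ)]`. The slope is
infinite at `ξ = 1/(2κ)`, where `slope` has a junk value. -/
noncomputable def profileTime (κ α ξ : ℝ) : ℝ :=
  if 2 * κ * ξ = 1 then 0 else travelTime κ α (slope κ α ξ)

section ProfileTime

variable {κ α ξ : ℝ}

theorem profileTime_pos (hκ : 0 < κ) (hα : 0 ≤ α) (hξ : 0 < ξ) (hlt : 2 * κ * ξ < 1) :
    0 < profileTime κ α ξ := by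
  rw [profileTime, if_neg hlt.ne]
  exact travelTime_pos hκ hα (lt_slope hκ hα hξ (sub_pos.2 hlt))

theorem mapsTo_profileTime (hκ : 0 < κ) (hα : 0 ≤ α) :
    MapsTo (profileTime κ α) (Ioc 0 (1 / (2 * κ))) (Ici 0) := by
  intro ξ hξ
  obtain heq | hlt := ((le_div_iff₀' (by positivity)).1 hξ.2).eq_or_lt
  · rw [profileTime, if_pos heq]
    exact self_mem_Ici
  · exact (profileTime_pos hκ hα hξ.1 hlt).le

theorem injOn_profileTime (hκ : 0 < κ) (hα : 0 ≤ α) :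
    InjOn (profileTime κ α) (Ioc 0 (1 / (2 * κ))) := by
  intro ξ hξ ζ hζ h
  obtain heq | hlt := ((le_div_iff₀' (by positivity)).1 hξ.2).eq_or_lt <;>
    obtain heq' | hlt' := ((le_div_iff₀' (by positivity)).1 hζ.2).eq_or_lt
  · exact mul_left_cancel₀ (by positivity) (heq.trans heq'.symm)
  · exact absurd ((if_pos heq).symm.trans h) (profileTime_pos hκ hα hζ.1 hlt').ne
  · exact absurd (h.trans (if_pos heq')) (profileTime_pos hκ hα hξ.1 hlt).ne'
  · rw [profileTime, profileTime, if_neg hlt.ne, if_neg hlt'.ne] at h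
    have hsub := sub_pos.2 hlt
    have hsub' := sub_pos.2 hlt'
    have hslope := (strictAntiOn_travelTime hκ hα).injOn (lt_slope hκ hα hξ.1 hsub)
      (lt_slope hκ hα hζ.1 hsub') h
    rw [eq_slope (α := α) hκ hξ.1.le hsub, hslope, ← eq_slope hκ hζ.1.le hsub']

end ProfileTime

/-- The profile equation `(1 - 2κξ) ξ'² = ξ² (α² + 2ξ)` on `(0, ∞)`, started from the singular value
`ξ = 1/(2κ)` and never returning to it. The intensity of a cuspon is a multiple of such a `ξ`. -/
structure IsNormalProfile (κ α : ℝ) (ξ : ℝ → ℝ) : Prop where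
  pos_param : 0 < κ
  nonneg_param : 0 ≤ α
  continuousOn : ContinuousOn ξ (Ici 0)
  contDiffOn : ContDiffOn ℝ 1 ξ (Ioi 0)
  init : 2 * κ * ξ 0 = 1
  ne : ∀ x, 0 < x → 2 * κ * ξ x ≠ 1
  eqn : ∀ x, 0 < x → (1 - 2 * κ * ξ x) * deriv ξ x ^ 2 = ξ x ^ 2 * (α ^ 2 + 2 * ξ x)

namespace IsNormalProfile

variable {κ α : ℝ} {ξ : ℝ → ℝ} {b x : ℝ}

theorem hasDerivAt (h : IsNormalProfile κ α ξ) (hx : 0 < x) : HasDerivAt ξ (deriv ξ x) x :=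
  ((h.contDiffOn.contDiffAt (Ioi_mem_nhds hx)).differentiableAt one_ne_zero).hasDerivAt

theorem one_sub_pos (h : IsNormalProfile κ α ξ) (hx : 0 < x) : 0 < 1 - 2 * κ * ξ x := by
  by_contra! hneg
  have hlt : 1 - 2 * κ * ξ x < 0 := lt_of_le_of_ne hneg fun e => h.ne x hx (by linarith)
  have hξ : 0 < ξ x := pos_of_mul_pos_right (by linarith : 0 < 2 * κ * ξ x)
    (by linarith [h.pos_param])
  have hrhs : 0 < ξ x ^ 2 * (α ^ 2 + 2 * ξ x) := by positivity
  rw [← h.eqn x hx] at hrhs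
  exact hrhs.not_ge (mul_nonpos_of_nonpos_of_nonneg hneg (sq_nonneg _))

theorem init_pos (h : IsNormalProfile κ α ξ) : 0 < ξ 0 :=
  pos_of_mul_pos_right (h.init.symm ▸ one_pos) (by linarith [h.pos_param])

theorem lt_init (h : IsNormalProfile κ α ξ) (hx : 0 < x) : ξ x < ξ 0 :=
  lt_of_mul_lt_mul_left (by linarith [h.one_sub_pos hx, h.init] : 2 * κ * ξ x < 2 * κ * ξ 0)
    (by linarith [h.pos_param])

theorem deriv_ne_zero_of_pos (h : IsNormalProfile κ α ξ) (hx : 0 < x) (hξ : 0 < ξ x) :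
    deriv ξ x ≠ 0 := fun h0 => by
  have hrhs : 0 < ξ x ^ 2 * (α ^ 2 + 2 * ξ x) := by positivity
  rw [← h.eqn x hx, h0, zero_pow two_ne_zero, mul_zero] at hrhs
  exact hrhs.false

theorem deriv_neg_of_pos (h : IsNormalProfile κ α ξ) (hpos : ∀ x ∈ Ioo 0 b, 0 < ξ x) :
    ∀ x ∈ Ioo 0 b, deriv ξ x < 0 := by
  intro x hx
  have hne : ∀ y ∈ Ioo 0 b, deriv ξ y ≠ 0 := fun y hy => h.deriv_ne_zero_of_pos hy.1 (hpos y hy)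
  by_contra! hnonneg
  have hderiv_pos : ∀ y ∈ Ioo 0 b, 0 < deriv ξ y := by
    intro y hy
    by_contra! hy'
    obtain ⟨z, hz, hz0⟩ := isPreconnected_Ioo.intermediate_value hy hx
      ((h.contDiffOn.continuousOn_deriv_of_isOpen isOpen_Ioi le_rfl).mono Ioo_subset_Ioi_self)
      ⟨hy', hnonneg⟩
    exact hne z hz hz0
  have hmono : StrictMonoOn ξ (Icc 0 x) := by
    refine strictMonoOn_of_deriv_pos (convex_Icc 0 x)
      (h.continuousOn.mono Icc_subset_Ici_self) fun y hy => ?_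
    rw [interior_Icc] at hy
    exact hderiv_pos y ⟨hy.1, hy.2.trans hx.2⟩
  exact (hmono (left_mem_Icc.2 hx.1.le) (right_mem_Icc.2 hx.1.le) hx.1).not_gt (h.lt_init hx.1)

theorem deriv_eq_of_pos (h : IsNormalProfile κ α ξ) (hpos : ∀ x ∈ Ioo 0 b, 0 < ξ x) :
    ∀ x ∈ Ioo 0 b, deriv ξ x = -(slope κ α (ξ x) * ξ x) := by
  intro x hx
  have hsub := h.one_sub_pos hx.1
  have hξ := hpos x hx
  have hsq : deriv ξ x ^ 2 = (slope κ α (ξ x) * ξ x) ^ 2 := by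
    rw [mul_pow, slope_sq hξ.le hsub, div_mul_eq_mul_div, eq_div_iff hsub.ne']
    linear_combination h.eqn x hx.1
  refine (sq_eq_sq_iff_eq_or_eq_neg.1 hsq).resolve_left fun heq => ?_
  have hnonneg : 0 ≤ slope κ α (ξ x) * ξ x := mul_nonneg (Real.sqrt_nonneg _) hξ.le
  exact (h.deriv_neg_of_pos hpos x hx).not_ge (heq ▸ hnonneg)

theorem hasDerivAt_slope_of_pos (h : IsNormalProfile κ α ξ) (hpos : ∀ x ∈ Ioo 0 b, 0 < ξ x)
    (hx : x ∈ Ioo 0 b) :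
    HasDerivAt (fun x => slope κ α (ξ x)) (-((slope κ α (ξ x) ^ 2 - α ^ 2) *
      ((1 + κ * slope κ α (ξ x) ^ 2) / (2 * (1 + κ * α ^ 2))))) x := by
  have hsub := h.one_sub_pos hx.1
  have hξ := hpos x hx
  have hslope_pos : 0 < slope κ α (ξ x) :=
    h.nonneg_param.trans_lt (lt_slope h.pos_param h.nonneg_param hξ hsub)
  have hξ' := h.hasDerivAt hx.1
  rw [h.deriv_eq_of_pos hpos x hx] at hξ'
  have hquot := ((hξ'.const_mul 2).const_add (α ^ 2)).div
    ((hξ'.const_mul (2 * κ)).const_sub 1) hsub.ne'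
  convert! hquot.sqrt (div_pos (by positivity) hsub).ne' using 1
  change _ = _ / (2 * slope κ α (ξ x))
  have hsq := slope_sq (α := α) hξ.le hsub
  have hone_sub := one_sub_eq_slope (α := α) h.pos_param hξ.le hsub
  have hξ_eq := eq_slope (α := α) h.pos_param hξ.le hsub
  have hκ := h.pos_param
  generalize slope κ α (ξ x) = s at *
  rw [show α ^ 2 + 2 * ξ x = s ^ 2 * (1 - 2 * κ * ξ x) by rw [hsq, div_mul_cancel₀ _ hsub.ne'],
    hone_sub, hξ_eq]
  field_simp
  ring

theorem tendsto_slope (h : IsNormalProfile κ α ξ) :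
    Tendsto (fun x => slope κ α (ξ x)) (𝓝[>] 0) atTop := by
  have hξ : Tendsto ξ (𝓝[>] 0) (𝓝 (ξ 0)) :=
    (h.continuousOn 0 self_mem_Ici).tendsto.mono_left (nhdsWithin_mono _ Ioi_subset_Ici_self)
  have hsub : Tendsto (fun x => 1 - 2 * κ * ξ x) (𝓝[>] 0) (𝓝[>] 0) := by
    refine tendsto_nhdsWithin_iff.2 ⟨?_, ?_⟩
    · have := (hξ.const_mul (2 * κ)).const_sub 1
      rwa [h.init, sub_self] at this
    · filter_upwards [self_mem_nhdsWithin] with x hx using h.one_sub_pos hx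
  have hinit : 0 < α ^ 2 + 2 * ξ 0 := by linarith [sq_nonneg α, h.init_pos]
  exact Real.tendsto_sqrt_atTop.comp <| ((hξ.const_mul 2).const_add _).pos_mul_atTop hinit
    (tendsto_inv_nhdsGT_zero.comp hsub)

theorem hasDerivAt_travelTime_slope_of_pos (h : IsNormalProfile κ α ξ)
    (hpos : ∀ x ∈ Ioo 0 b, 0 < ξ x) (hx : x ∈ Ioo 0 b) :
    HasDerivAt (fun x => travelTime κ α (slope κ α (ξ x))) 1 x := by
  have hκ := h.pos_param
  have hlt : α < slope κ α (ξ x) := lt_slope hκ h.nonneg_param (hpos x hx) (h.one_sub_pos hx.1)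
  have hsub : slope κ α (ξ x) ^ 2 - α ^ 2 ≠ 0 :=
    (sub_pos.2 (pow_lt_pow_left₀ hlt h.nonneg_param two_ne_zero)).ne'
  convert! (hasDerivAt_travelTime hκ h.nonneg_param hlt).comp x
    (h.hasDerivAt_slope_of_pos hpos hx) using 1
  field_simp

theorem travelTime_slope_of_pos (h : IsNormalProfile κ α ξ) (hpos : ∀ x ∈ Ioo 0 b, 0 < ξ x)
    (hx : x ∈ Ioo 0 b) : travelTime κ α (slope κ α (ξ x)) = x := by
  have hderiv : ∀ y ∈ Ioo 0 b,
      HasDerivAt (fun y => travelTime κ α (slope κ α (ξ y)) - y) 0 y := fun y hy => by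
    simpa only [sub_self] using!
      (h.hasDerivAt_travelTime_slope_of_pos hpos hy).sub (hasDerivAt_id' y)
  have hconst : ∀ y ∈ Ioo 0 b, travelTime κ α (slope κ α (ξ x)) - x
      = travelTime κ α (slope κ α (ξ y)) - y := fun y hy =>
    isOpen_Ioo.is_const_of_deriv_eq_zero isPreconnected_Ioo
      (fun z hz => (hderiv z hz).differentiableAt.differentiableWithinAt)
      (fun z hz => (hderiv z hz).deriv) hx hy
  have hlim : Tendsto (fun y => travelTime κ α (slope κ α (ξ y)) - y) (𝓝[>] 0) (𝓝 (0 - 0)) :=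
    ((tendsto_travelTime_atTop h.pos_param h.nonneg_param).comp h.tendsto_slope).sub
      (tendsto_id.mono_left nhdsWithin_le_nhds)
  rw [sub_zero] at hlim
  refine sub_eq_zero.1 (tendsto_nhds_unique (tendsto_const_nhds.congr' ?_) hlim)
  filter_upwards [Ioo_mem_nhdsGT (hx.1.trans hx.2)] with y hy using hconst y hy

theorem exists_first_zero (h : IsNormalProfile κ α ξ) (hx : 0 < x) (hξ : ξ x ≤ 0) :
    ∃ b, 0 < b ∧ ξ b = 0 ∧ ∀ y ∈ Ioo 0 b, 0 < ξ y := by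
  set Z : Set ℝ := Ici 0 ∩ ξ ⁻¹' Iic 0
  have hZ_closed : IsClosed Z :=
    h.continuousOn.preimage_isClosed_of_isClosed isClosed_Ici isClosed_Iic
  have hZ_bdd : BddBelow Z := ⟨0, fun y hy => hy.1⟩
  obtain ⟨hb_nonneg, hξb⟩ : sInf Z ∈ Z := hZ_closed.csInf_mem ⟨x, hx.le, hξ⟩ hZ_bdd
  have hb : 0 < sInf Z := hb_nonneg.lt_of_ne fun e => (h.init_pos.trans_le (e ▸ hξb)).false
  have hpos : ∀ y ∈ Ioo 0 (sInf Z), 0 < ξ y := fun y hy => by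
    by_contra! hy'
    exact (csInf_le hZ_bdd ⟨hy.1.le, hy'⟩).not_gt hy.2
  refine ⟨sInf Z, hb, le_antisymm hξb ?_, hpos⟩
  refine ge_of_tendsto ((h.hasDerivAt hb).continuousAt.tendsto.mono_left nhdsWithin_le_nhds)
    (Filter.mem_of_superset (Ioo_mem_nhdsLT hb) fun y hy => (hpos y hy).le)

-- At a first zero `b` of `ξ` the slope would tend to `α`, so the travel time, which equals the
-- position, would be infinite.
theorem pos (h : IsNormalProfile κ α ξ) (hx : 0 < x) : 0 < ξ x := by
  by_contra! hneg
  obtain ⟨b, hb, hξb, hpos⟩ := h.exists_first_zero hx hneg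
  have hslope : Tendsto (fun y => slope κ α (ξ y)) (𝓝[<] b) (𝓝[>] α) := by
    refine tendsto_nhdsWithin_iff.2 ⟨?_, ?_⟩
    · have hξ : ContinuousAt ξ b := (h.hasDerivAt hb).continuousAt
      have hcont : ContinuousAt (fun y => slope κ α (ξ y)) b :=
        ((continuousAt_const.add (hξ.const_mul 2)).div (continuousAt_const.sub (hξ.const_mul _))
          (by norm_num [hξb])).sqrt
      have hval : slope κ α (ξ b) = α := by simp [slope, hξb, Real.sqrt_sq h.nonneg_param]
      rw [ContinuousAt, hval] at hcont
      exact hcont.mono_left nhdsWithin_le_nhds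
    · filter_upwards [Ioo_mem_nhdsLT hb] with y hy
      exact Cuspon.lt_slope h.pos_param h.nonneg_param (hpos y hy) (h.one_sub_pos hy.1)
  refine not_tendsto_nhds_of_tendsto_atTop
    ((tendsto_travelTime_nhdsGT (κ := κ) h.nonneg_param).comp hslope) b
    ((tendsto_id.mono_left nhdsWithin_le_nhds).congr' ?_)
  filter_upwards [Ioo_mem_nhdsLT hb] with y hy
  exact (h.travelTime_slope_of_pos hpos hy).symm

theorem deriv_eq (h : IsNormalProfile κ α ξ) (hx : 0 < x) :
    deriv ξ x = -(slope κ α (ξ x) * ξ x) :=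
  h.deriv_eq_of_pos (fun _ hy => h.pos hy.1) x ⟨hx, lt_add_one x⟩

theorem hasDerivAt_slope (h : IsNormalProfile κ α ξ) (hx : 0 < x) :
    HasDerivAt (fun x => slope κ α (ξ x)) (-((slope κ α (ξ x) ^ 2 - α ^ 2) *
      ((1 + κ * slope κ α (ξ x) ^ 2) / (2 * (1 + κ * α ^ 2))))) x :=
  h.hasDerivAt_slope_of_pos (fun _ hy => h.pos hy.1) ⟨hx, lt_add_one x⟩

theorem travelTime_slope (h : IsNormalProfile κ α ξ) (hx : 0 < x) :
    travelTime κ α (slope κ α (ξ x)) = x :=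
  h.travelTime_slope_of_pos (fun _ hy => h.pos hy.1) ⟨hx, lt_add_one x⟩

theorem lt_slope (h : IsNormalProfile κ α ξ) (hx : 0 < x) : α < slope κ α (ξ x) :=
  Cuspon.lt_slope h.pos_param h.nonneg_param (h.pos hx) (h.one_sub_pos hx)

theorem mapsTo (h : IsNormalProfile κ α ξ) : MapsTo ξ (Ici 0) (Ioc 0 (1 / (2 * κ))) := by
  intro x (hx : 0 ≤ x)
  rw [mem_Ioc, le_div_iff₀' (by linarith [h.pos_param])]
  obtain rfl | hx := hx.eq_or_lt
  · exact ⟨h.init_pos, h.init.le⟩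
  · exact ⟨h.pos hx, (sub_pos.1 (h.one_sub_pos hx)).le⟩

theorem mem_Ioo (h : IsNormalProfile κ α ξ) (hx : 0 < x) : ξ x ∈ Ioo 0 (1 / (2 * κ)) :=
  ⟨h.pos hx, (lt_div_iff₀' (by linarith [h.pos_param])).2 (sub_pos.1 (h.one_sub_pos hx))⟩

theorem leftInvOn_profileTime (h : IsNormalProfile κ α ξ) :
    LeftInvOn (profileTime κ α) ξ (Ici 0) := by
  intro x (hx : 0 ≤ x)
  obtain rfl | hx := hx.eq_or_lt
  · exact if_pos h.init
  · rw [profileTime, if_neg (h.ne x hx), h.travelTime_slope hx]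

theorem rightInvOn_profileTime (h : IsNormalProfile κ α ξ) :
    RightInvOn (profileTime κ α) ξ (Ioc 0 (1 / (2 * κ))) :=
  (injOn_profileTime h.pos_param h.nonneg_param).rightInvOn_of_leftInvOn h.leftInvOn_profileTime
    (mapsTo_profileTime h.pos_param h.nonneg_param) h.mapsTo

theorem unique {ξ₁ ξ₂ : ℝ → ℝ} (h₁ : IsNormalProfile κ α ξ₁) (h₂ : IsNormalProfile κ α ξ₂) :
    EqOn ξ₁ ξ₂ (Ici 0) := fun x hx => by
  rw [← h₁.rightInvOn_profileTime (h₂.mapsTo hx), h₂.leftInvOn_profileTime hx]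

-- `ξ' = -slope · ξ`, and the slope is infinite at the cusp.
theorem tendsto_deriv (h : IsNormalProfile κ α ξ) : Tendsto (deriv ξ) (𝓝[>] 0) atBot := by
  have hξ : Tendsto ξ (𝓝[>] 0) (𝓝 (ξ 0)) :=
    (h.continuousOn 0 self_mem_Ici).tendsto.mono_left (nhdsWithin_mono _ Ioi_subset_Ici_self)
  refine (tendsto_neg_atTop_atBot.comp (h.tendsto_slope.atTop_mul_pos h.init_pos hξ)).congr' ?_
  filter_upwards [self_mem_nhdsWithin] with x hx using (h.deriv_eq hx).symm

end IsNormalProfile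

/-! ### Cuspons -/

section Parameters

variable {c κ α : ℝ}

/-- `α ≥ 0` is the exponential decay rate at infinity of a cuspon with parameters `(c, κ)`; it
vanishes for `c = √2`. -/
structure IsCuspParam (c κ α : ℝ) : Prop where
  pos : 0 < κ
  nonneg : 0 ≤ α
  ne : 2 * κ - 1 ≠ 0
  eqn : c ^ 2 - 2 = (2 * κ - 1) * α ^ 2

theorem IsCuspParam.neg (hp : IsCuspParam c κ α) : IsCuspParam (-c) κ α :=
  ⟨hp.pos, hp.nonneg, hp.ne, (neg_sq c).symm ▸ hp.eqn⟩

theorem IsCuspParam.sq_add_sq_pos (hp : IsCuspParam c κ α) {s : ℝ} (hs : α ≤ s) :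
    0 < s ^ 2 + c ^ 2 := by
  have hα : α ^ 2 ≤ s ^ 2 := pow_le_pow_left₀ hp.nonneg hs 2
  have hκα : 0 ≤ κ * α ^ 2 := mul_nonneg hp.pos.le (sq_nonneg α)
  linarith [hp.eqn]

theorem isCuspParam_sqrt (hκ : 0 < κ) (hne : 2 * κ - 1 ≠ 0)
    (hnonneg : 0 ≤ (c ^ 2 - 2) / (2 * κ - 1)) :
    IsCuspParam c κ √((c ^ 2 - 2) / (2 * κ - 1)) :=
  ⟨hκ, Real.sqrt_nonneg _, hne, by rw [Real.sq_sqrt hnonneg, mul_div_cancel₀ _ hne]⟩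

theorem two_mul_sub_one_neg (h : (c, κ) ∈ D1 ∪ BMinus) : 2 * κ - 1 < 0 := by
  obtain ⟨-, -, -, hlt⟩ | ⟨-, -, hlt⟩ := h <;> linarith

theorem two_mul_sub_one_pos (h : (c, κ) ∈ D3 ∪ BPlus) : 0 < 2 * κ - 1 := by
  obtain ⟨-, hlt⟩ | ⟨-, hlt⟩ := h <;> linarith

theorem exists_isCuspParam (h : (c, κ) ∈ DTilde) : ∃ α, IsCuspParam c κ α := by
  have hsq_B : c = √2 → (c ^ 2 - 2) / (2 * κ - 1) = 0 := by
    rintro rfl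
    rw [Real.sq_sqrt zero_le_two, sub_self, zero_div]
  obtain ((h | h) | h) | h := h
  · have hneg := two_mul_sub_one_neg (Or.inl h)
    exact ⟨_, isCuspParam_sqrt h.2.2.1 hneg.ne (div_nonneg_of_nonpos
      (sub_nonpos.2 ((Real.lt_sqrt h.1).1 h.2.1).le) hneg.le)⟩
  · have hpos := two_mul_sub_one_pos (Or.inl h)
    exact ⟨_, isCuspParam_sqrt (one_half_pos.trans h.2) hpos.ne' (div_nonneg
      (sub_nonneg.2 (Real.lt_sq_of_sqrt_lt h.1).le) hpos.le)⟩
  · exact ⟨_, isCuspParam_sqrt h.2.1 (two_mul_sub_one_neg (Or.inr h)).ne (hsq_B h.1).ge⟩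
  · exact ⟨_, isCuspParam_sqrt (one_half_pos.trans h.2) (two_mul_sub_one_pos (Or.inr h)).ne'
      (hsq_B h.1).ge⟩

theorem IsCuspParam.pos_of_mem (hp : IsCuspParam c κ α) (h : (c, κ) ∈ D1 ∪ D3) : 0 < α := by
  have hne : c ^ 2 ≠ 2 := h.elim (fun h => ((Real.lt_sqrt h.1).1 h.2.1).ne)
    fun h => (Real.lt_sq_of_sqrt_lt h.1).ne'
  exact hp.nonneg.lt_of_ne' fun h0 => hne (sub_eq_zero.1 (by simp [hp.eqn, h0]))

theorem IsCuspParam.eq_zero_of_mem (hp : IsCuspParam c κ α) (h : (c, κ) ∈ BPlus ∪ BMinus) :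
    α = 0 := by
  have heqn := hp.eqn
  rw [show c = √2 from h.elim And.left And.left, Real.sq_sqrt zero_le_two, sub_self, eq_comm,
    mul_eq_zero_iff_left hp.ne] at heqn
  exact pow_eq_zero_iff two_ne_zero |>.1 heqn

end Parameters

section Cusps

variable {c κ α a : ℝ} {v g : ℝ → ℂ} {I : Set ℝ} {x : ℝ}

/-- The intensity divided by `2κ - 1`, which makes the profile positive and gives its critical
value `1/(2κ)` in all parameter regions. -/
noncomputable def normalProfile (κ : ℝ) (v : ℝ → ℂ) (x : ℝ) : ℝ := intensity v x / (2 * κ - 1)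

theorem intensity_eq_normalProfile (hκ : 2 * κ - 1 ≠ 0) (v : ℝ → ℂ) (x : ℝ) :
    intensity v x = (2 * κ - 1) * normalProfile κ v x :=
  (mul_div_cancel₀ _ hκ).symm

theorem deriv_intensity (hκ : 2 * κ - 1 ≠ 0) (v : ℝ → ℂ) :
    deriv (intensity v) = fun x => (2 * κ - 1) * deriv (normalProfile κ v) x := by
  rw [funext (intensity_eq_normalProfile hκ v)]
  exact funext fun x => deriv_const_mul_field _

theorem two_mul_normalProfile_eq_one_iff (hκ : 0 < κ) (hκ' : 2 * κ - 1 ≠ 0) :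
    2 * κ * normalProfile κ v x = 1 ↔ x ∈ criticalSet κ v := by
  rw [criticalSet, mem_ofPred_eq, eq_div_iff (by positivity), normalProfile, mul_div_assoc',
    div_eq_one_iff_eq hκ', intensity]
  constructor <;> intro h <;> linarith

namespace HasFirstIntegralsOn

theorem normalProfile_eqn (h : HasFirstIntegralsOn c κ v I) (hp : IsCuspParam c κ α)
    (hx : I ∈ 𝓝 x) :
    (1 - 2 * κ * normalProfile κ v x) * deriv (normalProfile κ v) x ^ 2
      = normalProfile κ v x ^ 2 * (α ^ 2 + 2 * normalProfile κ v x) := by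
  have heqn := h.intensity_eqn hx
  rw [deriv_intensity hp.ne, intensity_eq_normalProfile hp.ne] at heqn
  refine mul_left_cancel₀ (pow_ne_zero 3 hp.ne) ?_
  linear_combination -heqn + ((2 * κ - 1) * normalProfile κ v x) ^ 2 * hp.eqn

theorem comp_const_sub (h : HasFirstIntegralsOn c κ v (Iio a)) :
    HasFirstIntegralsOn (-c) κ (fun x => v (a - x)) (Ioi 0) where
  contDiffOn := h.contDiffOn.comp (contDiff_const.sub contDiff_id).contDiffOn
    fun _ hx => sub_lt_self a hx
  momentum x hx := by
    rw [deriv_comp_const_sub, inner_neg_right, h.momentum _ (sub_lt_self a hx), intensity,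
      intensity]
    ring
  energy x hx := by
    rw [deriv_comp_const_sub, inner_neg_right, norm_neg, neg_sq, h.energy _ (sub_lt_self a hx),
      intensity, intensity]

theorem isNormalProfile (h : HasFirstIntegralsOn c κ v (Ioi 0)) (hp : IsCuspParam c κ α)
    (hv : Continuous v) (hzero : 0 ∈ criticalSet κ v) (hcrit : Ioi 0 ⊆ (criticalSet κ v)ᶜ) :
    IsNormalProfile κ α (normalProfile κ v) where
  pos_param := hp.pos
  nonneg_param := hp.nonneg
  continuousOn := ((continuous_const.sub (hv.norm.pow 2)).div_const _).continuousOn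
  contDiffOn := (contDiffOn_const.sub
    ((h.contDiffOn.of_le (by simp)).norm_sq ℝ)).div_const _
  init := (two_mul_normalProfile_eq_one_iff hp.pos hp.ne).2 hzero
  ne _ hx := mt (two_mul_normalProfile_eq_one_iff hp.pos hp.ne).1 (hcrit hx)
  eqn _ hx := h.normalProfile_eqn hp (Ioi_mem_nhds hx)

end HasFirstIntegralsOn

/-- A function that satisfies the travelling wave equation outside `[a, 0]` and has cusps at `a` and
`0`. -/
structure IsCuspon (c κ α : ℝ) (v : ℝ → ℂ) (a : ℝ) : Prop where
  param : IsCuspParam c κ α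
  nonpos : a ≤ 0
  hasFirstIntegralsOn : HasFirstIntegralsOn c κ v (Iio a ∪ Ioi 0)
  right : IsNormalProfile κ α (normalProfile κ v)
  left : IsNormalProfile κ α fun x => normalProfile κ v (a - x)

theorem IsFiniteEnergySolution.isCuspon (h : IsFiniteEnergySolution c κ v g)
    (hp : IsCuspParam c κ α) (hne : (criticalSet κ v).Nonempty)
    (hbdd : Bornology.IsBounded (criticalSet κ v)) (hsup : sSup (criticalSet κ v) = 0) :
    IsCuspon c κ α v (sInf (criticalSet κ v)) := by
  have hclosed := isClosed_criticalSet (κ := κ) h.continuous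
  have hsup_mem := hsup ▸ hclosed.csSup_mem hne hbdd.bddAbove
  have hinf_mem := hclosed.csInf_mem hne hbdd.bddBelow
  have hright_crit : Ioi 0 ⊆ (criticalSet κ v)ᶜ := fun x (hx : 0 < x) =>
    notMem_of_csSup_lt (hsup.trans_lt hx) hbdd.bddAbove
  have hleft_crit : Iio (sInf (criticalSet κ v)) ⊆ (criticalSet κ v)ᶜ := fun x hx =>
    notMem_of_lt_csInf hx hbdd.bddBelow
  have hright := h.hasFirstIntegralsOn isOpen_Ioi isPreconnected_Ioi Real.volume_Ioi hright_crit
  have hleft := h.hasFirstIntegralsOn isOpen_Iio isPreconnected_Iio Real.volume_Iio hleft_crit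
  refine ⟨hp, hsup ▸ csInf_le_csSup hne hbdd.bddBelow hbdd.bddAbove,
    hleft.union hright isOpen_Iio isOpen_Ioi,
    hright.isNormalProfile hp h.continuous hsup_mem hright_crit,
    hleft.comp_const_sub.isNormalProfile hp.neg (h.continuous.comp (continuous_sub_left _)) ?_
      fun x (hx : 0 < x) => hleft_crit (mem_Iio.2 (sub_lt_self _ hx))⟩
  rwa [criticalSet, mem_ofPred_eq, sub_zero]

end Cusps

section ExplicitProfiles

variable {c κ α ξ : ℝ}

theorem one_sub_one_div_eq (hκ : 0 < κ) : 1 - 1 / (2 * κ) = (2 * κ - 1) * (1 / (2 * κ)) := by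
  field_simp

theorem mul_mem_intervalT_iff (hκ : 0 < κ) (hneg : 2 * κ - 1 < 0) :
    (2 * κ - 1) * ξ ∈ intervalT κ ↔ ξ ∈ Ioc 0 (1 / (2 * κ)) := by
  rw [intervalT, mem_Ico, mem_Ioc, one_sub_one_div_eq hκ, mul_le_mul_left_of_neg hneg, and_comm,
    mul_neg_iff, and_iff_right hneg, or_iff_right fun h => h.1.not_gt hneg]

theorem mul_mem_intervalJ_iff (hκ : 0 < κ) (hpos : 0 < 2 * κ - 1) :
    (2 * κ - 1) * ξ ∈ intervalJ κ ↔ ξ ∈ Ioc 0 (1 / (2 * κ)) := by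
  rw [intervalJ, mem_Ioc, mem_Ioc, one_sub_one_div_eq hκ, mul_le_mul_iff_right₀ hpos,
    mul_pos_iff_of_pos_left hpos]

theorem mul_eq_one_sub_iff (hκ : 0 < κ) (hne : 2 * κ - 1 ≠ 0) :
    (2 * κ - 1) * ξ = 1 - 1 / (2 * κ) ↔ 2 * κ * ξ = 1 := by
  rw [one_sub_one_div_eq hκ, mul_right_inj' hne, eq_div_iff (by positivity), mul_comm]

theorem profileF_mul (hp : IsCuspParam c κ α) (hα : 0 < α) (hξ : ξ ∈ Ioc 0 (1 / (2 * κ))) :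
    profileF c κ ((2 * κ - 1) * ξ) = profileTime κ α ξ := by
  have hκ := hp.pos
  rw [profileF, profileTime]
  refine if_congr (mul_eq_one_sub_iff hκ hp.ne) rfl rfl |>.trans (ite_congr rfl (fun _ => rfl)
    fun hne => ?_)
  have hξ₀ : 0 < ξ := hξ.1
  have hsub : 0 < 1 - 2 * κ * ξ :=
    sub_pos.2 (((le_div_iff₀' (by positivity)).1 hξ.2).lt_of_ne hne)
  have hslope : 0 < slope κ α ξ := hα.trans (lt_slope hκ hα.le hξ₀ hsub)
  have hnum : α ^ 2 + 2 * ξ ≠ 0 := by positivity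
  have hne' : 2 * κ - 1 ≠ 0 := hp.ne
  have hneg : -(2 * κ - 1) ≠ 0 := neg_ne_zero.2 hne'
  rw [show 2 - c ^ 2 - 2 * ((2 * κ - 1) * ξ) = -(2 * κ - 1) * (α ^ 2 + 2 * ξ) by
      linear_combination -hp.eqn,
    show 1 - 2 * κ + 2 * κ * ((2 * κ - 1) * ξ) = -(2 * κ - 1) * (1 - 2 * κ * ξ) by ring,
    show 2 - c ^ 2 = -(2 * κ - 1) * α ^ 2 by linear_combination -hp.eqn, ← neg_sub (2 * κ) 1,
    mul_div_mul_left _ _ hneg, ← slope]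
  have hfactor : √(-(2 * κ - 1) / (-(2 * κ - 1) * α ^ 2)) = 1 / α := by
    rw [show -(2 * κ - 1) / (-(2 * κ - 1) * α ^ 2) = (1 / α) ^ 2 by field_simp,
      Real.sqrt_sq (by positivity)]
  have hratio : √(-(2 * κ - 1) * α ^ 2 * (-(2 * κ - 1) * (1 - 2 * κ * ξ)) /
      (-(2 * κ - 1) * (-(2 * κ - 1) * (α ^ 2 + 2 * ξ)))) = α / slope κ α ξ := by
    rw [show -(2 * κ - 1) * α ^ 2 * (-(2 * κ - 1) * (1 - 2 * κ * ξ)) /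
        (-(2 * κ - 1) * (-(2 * κ - 1) * (α ^ 2 + 2 * ξ))) = (α / slope κ α ξ) ^ 2 by
      rw [div_pow, slope_sq hξ₀.le hsub]
      field_simp]
    exact Real.sqrt_sq (by positivity)
  rw [hfactor, hratio, travelTime, hyperbolicTime, if_neg hα.ne', mul_one_div]

theorem profileG_mul (hκ : 0 < κ) (hne : 2 * κ - 1 ≠ 0) (hξ : ξ ∈ Ioc 0 (1 / (2 * κ))) :
    profileG κ ((2 * κ - 1) * ξ) = profileTime κ 0 ξ := by
  rw [profileG, profileTime]
  refine if_congr (mul_eq_one_sub_iff hκ hne) rfl rfl |>.trans (ite_congr rfl (fun _ => rfl)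
    fun hne' => ?_)
  have hξ₀ : 0 < ξ := hξ.1
  have hsub : 0 < 1 - 2 * κ * ξ :=
    sub_pos.2 (((le_div_iff₀' (by positivity)).1 hξ.2).lt_of_ne hne')
  have hslope : 0 < slope κ 0 ξ := lt_slope hκ le_rfl hξ₀ hsub
  have hneg : -(2 * κ - 1) ≠ 0 := neg_ne_zero.2 hne
  rw [show 1 - 2 * κ + 2 * κ * ((2 * κ - 1) * ξ) = -(2 * κ - 1) * (1 - 2 * κ * ξ) by ring]
  have harctan : √(-2 * κ * ((2 * κ - 1) * ξ) / (-(2 * κ - 1) * (1 - 2 * κ * ξ)))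
      = √κ * slope κ 0 ξ := by
    rw [show -2 * κ * ((2 * κ - 1) * ξ) = -(2 * κ - 1) * (κ * (0 ^ 2 + 2 * ξ)) by ring,
      mul_div_mul_left _ _ hneg, mul_div_assoc, Real.sqrt_mul hκ.le, slope]
  have hratio : √2 * √(-(-(2 * κ - 1) * (1 - 2 * κ * ξ) / ((2 * κ - 1) * ξ)))
      = 2 / slope κ 0 ξ := by
    rw [← Real.sqrt_mul zero_le_two, show 2 * -(-(2 * κ - 1) * (1 - 2 * κ * ξ) /
        ((2 * κ - 1) * ξ)) = (2 / slope κ 0 ξ) ^ 2 by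
      rw [div_pow, slope_sq hξ₀.le hsub]
      field_simp
      ring]
    exact Real.sqrt_sq (by positivity)
  rw [harctan, hratio, travelTime, hyperbolicTime_zero]

end ExplicitProfiles

namespace IsCuspon

variable {c κ α a x : ℝ} {v : ℝ → ℂ}

theorem eqInverseOnNonneg (h : IsCuspon c κ α v a) {F : ℝ → ℝ} {S : Set ℝ}
    (hS : ∀ ξ, (2 * κ - 1) * ξ ∈ S ↔ ξ ∈ Ioc 0 (1 / (2 * κ)))
    (hF : ∀ ξ ∈ Ioc 0 (1 / (2 * κ)), F ((2 * κ - 1) * ξ) = profileTime κ α ξ) :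
    EqInverseOnNonneg (intensity v) F S := by
  have hη := intensity_eq_normalProfile h.param.ne v
  have hmapsTo_intensity : MapsTo (intensity v) (Ici 0) S := fun x hx => by
    rw [hη, hS]
    exact h.right.mapsTo hx
  have hleft : LeftInvOn F (intensity v) (Ici 0) := fun x hx => by
    rw [hη, hF _ (h.right.mapsTo hx), h.right.leftInvOn_profileTime hx]
  have exists_eq : ∀ y ∈ S, ∃ ξ ∈ Ioc 0 (1 / (2 * κ)), (2 * κ - 1) * ξ = y := fun y hy => by
    have heq : (2 * κ - 1) * (y / (2 * κ - 1)) = y := mul_div_cancel₀ _ h.param.ne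
    exact ⟨_, (hS _).1 (heq.symm ▸ hy :), heq⟩
  have hmapsTo : MapsTo F S (Ici 0) := fun y hy => by
    obtain ⟨ξ, hξ, rfl⟩ := exists_eq y hy
    rw [hF ξ hξ]
    exact mapsTo_profileTime h.param.pos h.param.nonneg hξ
  have hright : LeftInvOn (intensity v) F S := fun y hy => by
    obtain ⟨ξ, hξ, rfl⟩ := exists_eq y hy
    rw [hF ξ hξ, hη, h.right.rightInvOn_profileTime hξ]
  refine ⟨InvOn.bijOn ⟨hright, hleft⟩ hmapsTo hmapsTo_intensity, fun x hx => ?_⟩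
  have := hright.injOn.leftInvOn_invFunOn (hmapsTo_intensity hx)
  rwa [hleft hx, eq_comm] at this

theorem eqInverse_profileF (h : IsCuspon c κ α v a) (hα : 0 < α) {S : Set ℝ}
    (hS : ∀ ξ, (2 * κ - 1) * ξ ∈ S ↔ ξ ∈ Ioc 0 (1 / (2 * κ))) :
    EqInverseOnNonneg (intensity v) (profileF c κ) S :=
  h.eqInverseOnNonneg hS fun _ => profileF_mul h.param hα

theorem eqInverse_profileG (h : IsCuspon c κ α v a) (hα : α = 0) {S : Set ℝ}
    (hS : ∀ ξ, (2 * κ - 1) * ξ ∈ S ↔ ξ ∈ Ioc 0 (1 / (2 * κ))) :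
    EqInverseOnNonneg (intensity v) (profileG κ) S :=
  h.eqInverseOnNonneg hS fun _ => hα.symm ▸ profileG_mul h.param.pos h.param.ne

theorem intensity_reflect (h : IsCuspon c κ α v a) (hx : x ≤ a) :
    intensity v x = intensity v (a - x) := by
  have heq := h.left.unique h.right (sub_nonneg.2 hx)
  simp only [sub_sub_cancel] at heq
  rw [intensity_eq_normalProfile h.param.ne, heq, ← intensity_eq_normalProfile h.param.ne]

theorem normalProfile_mem_Ioo (h : IsCuspon c κ α v a) (hx : x ∈ Iio a ∪ Ioi 0) :
    normalProfile κ v x ∈ Ioo 0 (1 / (2 * κ)) := by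
  obtain hx | hx := hx
  · rw [← sub_sub_cancel a x]
    exact h.left.mem_Ioo (sub_pos.2 hx)
  · exact h.right.mem_Ioo hx

theorem intensity_mem_Ioo_of_neg (h : IsCuspon c κ α v a) (hneg : 2 * κ - 1 < 0)
    (hx : x ∈ Iio a ∪ Ioi 0) : intensity v x ∈ Ioo (1 - 1 / (2 * κ)) 0 := by
  obtain ⟨hpos, hlt⟩ := h.normalProfile_mem_Ioo hx
  rw [intensity_eq_normalProfile h.param.ne, one_sub_one_div_eq h.param.pos]
  exact ⟨mul_lt_mul_of_neg_left hlt hneg, mul_neg_of_neg_of_pos hneg hpos⟩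

theorem intensity_mem_Ioo_of_pos (h : IsCuspon c κ α v a) (hpos : 0 < 2 * κ - 1)
    (hx : x ∈ Iio a ∪ Ioi 0) : intensity v x ∈ Ioo 0 (1 - 1 / (2 * κ)) := by
  obtain ⟨hξ, hlt⟩ := h.normalProfile_mem_Ioo hx
  rw [intensity_eq_normalProfile h.param.ne, one_sub_one_div_eq h.param.pos]
  exact ⟨mul_pos hpos hξ, mul_lt_mul_of_pos_left hlt hpos⟩

theorem ne_zero (h : IsCuspon c κ α v a) (hx : x ∈ Iio a ∪ Ioi 0) : v x ≠ 0 := fun hv => by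
  obtain ⟨hpos, hlt⟩ := h.normalProfile_mem_Ioo hx
  have hη := intensity_eq_normalProfile h.param.ne v x
  rw [lt_div_iff₀' (by linarith [h.param.pos])] at hlt
  rw [intensity, hv, norm_zero] at hη
  linarith

theorem exists_phase (h : IsCuspon c κ α v a) :
    ∃ θ : ℝ → ℝ, ∀ x ∈ Iio a ∪ Ioi 0,
      v x = (√(1 - intensity v x) : ℂ) * Complex.exp (Complex.I * (θ x : ℂ)) ∧
      HasDerivAt θ (c * intensity v x / (2 - 2 * intensity v x)) x := by
  have hsmooth : ContDiffOn ℝ 1 v (Iio a ∪ Ioi 0) :=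
    h.hasFirstIntegralsOn.contDiffOn.of_le (by simp)
  obtain ⟨θ₁, hθ₁⟩ := exists_phase_hasDerivAt isOpen_Iio isPreconnected_Iio
    (hsmooth.mono subset_union_left) fun x hx => h.ne_zero (Or.inl hx)
  obtain ⟨θ₂, hθ₂⟩ := exists_phase_hasDerivAt isOpen_Ioi isPreconnected_Ioi
    (hsmooth.mono subset_union_right) fun x hx => h.ne_zero (Or.inr hx)
  refine ⟨(Iio a).piecewise θ₁ θ₂, fun x hx => ?_⟩
  have hsq : ‖v x‖ ^ 2 = 1 - intensity v x := by rw [intensity, sub_sub_cancel]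
  rw [← hsq, Real.sqrt_sq (norm_nonneg _), show c * intensity v x / (2 - 2 * intensity v x)
    = ⟪Complex.I * v x, deriv v x⟫_ℝ / ‖v x‖ ^ 2 by
      rw [h.hasFirstIntegralsOn.momentum x hx, hsq, div_mul_eq_mul_div, div_div, mul_one_sub]]
  obtain hx | hx := hx
  · have heq : (Iio a).piecewise θ₁ θ₂ =ᶠ[𝓝 x] θ₁ :=
      (piecewise_eqOn _ _ _).eventuallyEq_of_mem (Iio_mem_nhds hx)
    exact ⟨heq.eq_of_nhds ▸ (hθ₁ x hx).1, (hθ₁ x hx).2.congr_of_eventuallyEq heq⟩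
  · have heq : (Iio a).piecewise θ₁ θ₂ =ᶠ[𝓝 x] θ₂ :=
      (piecewise_eqOn_compl _ _ _).eventuallyEq_of_mem <|
        Filter.mem_of_superset (Ioi_mem_nhds hx) fun y hy => (h.nonpos.trans_lt hy).not_gt
    exact ⟨heq.eq_of_nhds ▸ (hθ₂ x hx).1, (hθ₂ x hx).2.congr_of_eventuallyEq heq⟩

theorem tendsto_deriv_normalProfile_left (h : IsCuspon c κ α v a) :
    Tendsto (deriv (normalProfile κ v)) (𝓝[<] a) atTop := by
  have hsub : Tendsto (fun x => a - x) (𝓝[<] a) (𝓝[>] 0) := by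
    refine tendsto_nhdsWithin_iff.2 ⟨?_, ?_⟩
    · exact ((continuous_sub_left a).tendsto' a 0 (sub_self a)).mono_left nhdsWithin_le_nhds
    · filter_upwards [self_mem_nhdsWithin] with x hx using sub_pos.2 (mem_Iio.1 hx)
  refine (tendsto_neg_atBot_atTop.comp (h.left.tendsto_deriv.comp hsub)).congr fun x => ?_
  simp only [Function.comp_apply, deriv_comp_const_sub, sub_sub_cancel, neg_neg]

theorem tendsto_deriv_of_neg (h : IsCuspon c κ α v a) (hneg : 2 * κ - 1 < 0) :
    Tendsto (deriv (intensity v)) (𝓝[<] a) atBot ∧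
      Tendsto (deriv (intensity v)) (𝓝[>] 0) atTop := by
  rw [deriv_intensity h.param.ne]
  exact ⟨h.tendsto_deriv_normalProfile_left.const_mul_atTop_of_neg hneg,
    h.right.tendsto_deriv.const_mul_atBot_of_neg hneg⟩

theorem tendsto_deriv_of_pos (h : IsCuspon c κ α v a) (hpos : 0 < 2 * κ - 1) :
    Tendsto (deriv (intensity v)) (𝓝[<] a) atTop ∧
      Tendsto (deriv (intensity v)) (𝓝[>] 0) atBot := by
  rw [deriv_intensity h.param.ne]
  exact ⟨h.tendsto_deriv_normalProfile_left.const_mul_atTop hpos,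
    h.right.tendsto_deriv.const_mul_atBot hpos⟩

end IsCuspon

/-! ### Decay -/

section WeightedDerivatives

variable {A : Type*} [NormedRing A] [NormedAlgebra ℝ A] {U I : Set ℝ} {r w b m n k l : ℝ → ℝ}
  {H h u F : ℝ → A} {x : ℝ}

/-- On `I`, `r` solves `r' = w(r) b(r)` and `u` solves the linear equation `u' = w(r) h(r) u`, where
`w`, `b` and `h` are smooth on the open set `U` that contains the values of `r`. -/
structure IsDrivenOn (w b : ℝ → ℝ) (h : ℝ → A) (U I : Set ℝ) (r : ℝ → ℝ) (u : ℝ → A) : Prop where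
  isOpen_coeff : IsOpen U
  isOpen : IsOpen I
  mapsTo : MapsTo r I U
  contDiff_weight : ContDiff ℝ ∞ w
  contDiffOn_drift : ContDiffOn ℝ ∞ b U
  contDiffOn_coeff : ContDiffOn ℝ ∞ h U
  hasDerivAt_driver : ∀ x ∈ I, HasDerivAt r (w (r x) * b (r x)) x
  hasDerivAt : ∀ x ∈ I, HasDerivAt u (w (r x) • (h (r x) * u x)) x

/-- On `I`, `F = m(r) H(r) u` with a coefficient `H` that is smooth on `U`: the size of `F` is
controlled by the weight `m`. -/
def HasWeightOn (U I : Set ℝ) (r : ℝ → ℝ) (u : ℝ → A) (m : ℝ → ℝ) (F : ℝ → A) : Prop :=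
  ∃ H : ℝ → A, ContDiffOn ℝ ∞ H U ∧ ∀ x ∈ I, F x = m (r x) • (H (r x) * u x)

theorem IsDrivenOn.hasDerivAt_smul_mul (hu : IsDrivenOn w b h U I r u) (hm : Differentiable ℝ m)
    (hH : ContDiffOn ℝ ∞ H U) (hx : x ∈ I) :
    HasDerivAt (fun x => m (r x) • (H (r x) * u x))
      ((deriv m (r x) * w (r x)) • (b (r x) • (H (r x) * u x)) +
        (m (r x) * w (r x)) • ((b (r x) • deriv H (r x) + H (r x) * h (r x)) * u x)) x := by
  have hr := hu.hasDerivAt_driver x hx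
  have hHr : HasDerivAt H (deriv H (r x)) (r x) :=
    ((hH.contDiffAt (hu.isOpen_coeff.mem_nhds (hu.mapsTo hx))).differentiableAt
      (by simp)).hasDerivAt
  convert! ((hm (r x)).hasDerivAt.comp x hr).smul ((hHr.scomp x hr).mul (hu.hasDerivAt x hx))
    using 1
  simp only [Function.comp_apply, Pi.mul_apply, smul_mul_assoc, mul_smul_comm, smul_add, add_mul,
    smul_smul, mul_assoc]
  abel

protected theorem HasWeightOn.deriv (hF : HasWeightOn U I r u m F) (hu : IsDrivenOn w b h U I r u)
    (hm : Differentiable ℝ m) (hk : ContDiff ℝ ∞ k) (hl : ContDiff ℝ ∞ l)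
    (hmk : ∀ s, deriv m s * w s = n s * k s) (hml : ∀ s, m s * w s = n s * l s) :
    HasWeightOn U I r u n (deriv F) := by
  obtain ⟨H, hH, hFH⟩ := hF
  refine ⟨fun s => (k s * b s) • H s + l s • (b s • deriv H s + H s * h s), ?_,
    fun x hx => ?_⟩
  · have hH' := ((contDiffOn_infty_iff_deriv_of_isOpen hu.isOpen_coeff).1 hH).2
    exact ((hk.contDiffOn.mul hu.contDiffOn_drift).smul hH).add
      (hl.contDiffOn.smul ((hu.contDiffOn_drift.smul hH').add (hH.mul hu.contDiffOn_coeff)))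
  · have heq : F =ᶠ[𝓝 x] fun x => m (r x) • (H (r x) * u x) :=
      (show EqOn F _ I from hFH).eventuallyEq_of_mem (hu.isOpen.mem_nhds hx)
    rw [heq.deriv_eq, (hu.hasDerivAt_smul_mul hm hH hx).deriv, hmk, hml]
    simp only [smul_mul_assoc, smul_add, add_mul, smul_smul, mul_assoc]

theorem HasWeightOn.iteratedDeriv_self (hF : HasWeightOn U I r u w F)
    (hu : IsDrivenOn w b h U I r u) (j : ℕ) : HasWeightOn U I r u w (iteratedDeriv j F) := by
  induction j with
  | zero => rwa [iteratedDeriv_zero]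
  | succ j ih =>
    rw [iteratedDeriv_succ]
    exact ih.deriv hu (hu.contDiff_weight.differentiable (by simp))
      (contDiff_infty_iff_deriv.1 hu.contDiff_weight).2 hu.contDiff_weight (fun s => mul_comm _ _)
      fun s => rfl

theorem HasWeightOn.iteratedDeriv_sq (hF : HasWeightOn U I r u w F)
    (hu : IsDrivenOn w b h U I r u) (hw : ∀ s, w s = s ^ 2) (j : ℕ) :
    HasWeightOn U I r u (fun s => s ^ (2 + j)) (iteratedDeriv j F) := by
  induction j with
  | zero =>
    rw [iteratedDeriv_zero]
    simpa only [funext hw] using hF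
  | succ j ih =>
    rw [iteratedDeriv_succ]
    refine ih.deriv hu (differentiable_pow _) (k := fun _ => 2 + j) contDiff_const contDiff_id
      (fun s => ?_) fun s => ?_
    · rw [deriv_pow_field, hw, Nat.cast_add, Nat.cast_two, show 2 + j - 1 = 1 + j by omega]
      ring
    · rw [hw, id]
      ring

end WeightedDerivatives

section SlopeDecay

variable {κ α : ℝ} {ξ : ℝ → ℝ}

namespace IsNormalProfile

theorem antitoneOn_slope (h : IsNormalProfile κ α ξ) :
    AntitoneOn (fun x => slope κ α (ξ x)) (Ioi 0) := fun x hx y hy hxy => by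
  rwa [← (strictAntiOn_travelTime h.pos_param h.nonneg_param).le_iff_ge (h.lt_slope hx)
    (h.lt_slope hy), h.travelTime_slope hx, h.travelTime_slope hy]

theorem slope_le_two_div (h : IsNormalProfile κ 0 ξ) {x : ℝ} (hx : 0 < x) :
    slope κ 0 (ξ x) ≤ 2 / x := by
  have htime := h.travelTime_slope hx
  have harctan : 2 * √κ * Real.arctan (√κ * slope κ 0 (ξ x)) ≤ 2 * √κ * (Real.pi / 2) := by
    gcongr
    exact (Real.arctan_lt_pi_div_two _).le
  rw [travelTime, hyperbolicTime_zero] at htime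
  rw [le_div_comm₀ (h.lt_slope hx) hx]
  linarith

theorem antitoneOn_mul_exp (h : IsNormalProfile κ α ξ) :
    AntitoneOn (fun x => ξ x * Real.exp (α * x)) (Ioi 0) := by
  have hderiv : ∀ x, 0 < x → HasDerivAt (fun x => ξ x * Real.exp (α * x))
      (ξ x * Real.exp (α * x) * (α - slope κ α (ξ x))) x := fun x hx => by
    convert! (h.hasDerivAt hx).mul ((hasDerivAt_const_mul α).exp) using 1
    rw [h.deriv_eq hx]
    ring
  refine antitoneOn_of_hasDerivWithinAt_nonpos (convex_Ioi 0)
    (fun x hx => (hderiv x hx).continuousAt.continuousWithinAt)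
    (fun x hx => (hderiv x (interior_subset hx)).hasDerivWithinAt) fun x hx => ?_
  have hx : 0 < x := interior_subset hx
  exact mul_nonpos_of_nonneg_of_nonpos (mul_pos (h.pos hx) (Real.exp_pos _)).le
    (sub_nonpos.2 (h.lt_slope hx).le)

theorem exists_slope_sq_sub_le (h : IsNormalProfile κ α ξ) :
    ∃ C, 0 < C ∧ ∀ x, 1 ≤ x → slope κ α (ξ x) ^ 2 - α ^ 2 ≤ C * Real.exp (-α * x) := by
  have hκ := h.pos_param
  have hξ := h.pos one_pos
  refine ⟨2 * (1 + κ * slope κ α (ξ 1) ^ 2) * (ξ 1 * Real.exp α), by positivity, fun x hx => ?_⟩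
  have hx₀ : 0 < x := one_pos.trans_le hx
  have hslope : slope κ α (ξ x) ≤ slope κ α (ξ 1) :=
    h.antitoneOn_slope (mem_Ioi.2 one_pos) hx₀ hx
  have hslope₀ : 0 ≤ slope κ α (ξ x) := Real.sqrt_nonneg _
  have hexp : ξ x * Real.exp (α * x) ≤ ξ 1 * Real.exp α := by
    simpa only [mul_one] using h.antitoneOn_mul_exp (mem_Ioi.2 one_pos) hx₀ hx
  have heq : slope κ α (ξ x) ^ 2 - α ^ 2 = 2 * (1 + κ * slope κ α (ξ x) ^ 2) * ξ x := by
    have := eq_slope (α := α) hκ (h.pos hx₀).le (h.one_sub_pos hx₀)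
    rw [eq_div_iff (by positivity)] at this
    linarith
  rw [heq, neg_mul, Real.exp_neg, ← div_eq_mul_inv, le_div_iff₀ (Real.exp_pos _), mul_assoc]
  have := h.pos hx₀
  gcongr

end IsNormalProfile
end SlopeDecay

section Decay

variable {c κ α a s : ℝ} {v : ℝ → ℂ} {x : ℝ}

/-- The decay rate `-η'/η` of the intensity `η` of `v`. -/
noncomputable def rate (κ α : ℝ) (v : ℝ → ℂ) (x : ℝ) : ℝ := slope κ α (normalProfile κ v x)

/-- The logarithmic derivative `v'/v` of a cuspon as a function of the rate `s`, up to the factor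
`s² - α²`. -/
noncomputable def logDeriv (c κ s : ℝ) : ℂ :=
  ((2 * κ - 1) / (2 * (s ^ 2 + c ^ 2))) • ((s : ℂ) + Complex.I * c)

/-- The set on which `logDeriv c κ` is smooth. -/
def regularSet (c : ℝ) : Set ℝ := {s | s ^ 2 + c ^ 2 ≠ 0}

theorem isOpen_regularSet (c : ℝ) : IsOpen (regularSet c) :=
  isOpen_ne_fun (by fun_prop) continuous_const

theorem contDiffOn_logDeriv (c κ : ℝ) : ContDiffOn ℝ ∞ (logDeriv c κ) (regularSet c) :=
  (contDiffOn_const.div (ContDiff.contDiffOn (by fun_prop))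
    fun _ hs => mul_ne_zero two_ne_zero hs).smul
      (Complex.ofRealCLM.contDiff.add contDiff_const).contDiffOn

theorem norm_sq_smul_eq_inner (z w : ℂ) :
    ‖z‖ ^ 2 • w = ⟪z, w⟫_ℝ • z + ⟪Complex.I * z, w⟫_ℝ • (Complex.I * z) := by
  rw [Complex.sq_norm, Complex.normSq_apply]
  apply Complex.ext <;> simp [Complex.inner] <;> ring

namespace IsCuspon

theorem lt_rate (h : IsCuspon c κ α v a) (hx : 0 < x) : α < rate κ α v x := h.right.lt_slope hx

theorem rate_mem_regularSet (h : IsCuspon c κ α v a) (hx : 0 < x) :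
    rate κ α v x ∈ regularSet c :=
  (h.param.sq_add_sq_pos (h.lt_rate hx).le).ne'

theorem hasDerivAt_rate (h : IsCuspon c κ α v a) (hx : 0 < x) :
    HasDerivAt (rate κ α v) ((rate κ α v x ^ 2 - α ^ 2) *
      -((1 + κ * rate κ α v x ^ 2) / (2 * (1 + κ * α ^ 2)))) x := by
  rw [mul_neg]
  exact h.right.hasDerivAt_slope hx

theorem intensity_eq_rate (h : IsCuspon c κ α v a) (hx : 0 < x) :
    intensity v x = (rate κ α v x ^ 2 - α ^ 2) *
      ((2 * κ - 1) / (2 * (1 + κ * rate κ α v x ^ 2))) := by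
  rw [intensity_eq_normalProfile h.param.ne,
    eq_slope (α := α) h.param.pos (h.right.pos hx).le (h.right.one_sub_pos hx), ← rate]
  ring

theorem norm_sq_eq_rate (h : IsCuspon c κ α v a) (hx : 0 < x) :
    ‖v x‖ ^ 2 = (rate κ α v x ^ 2 + c ^ 2) / (2 * (1 + κ * rate κ α v x ^ 2)) := by
  have hκ := h.param.pos
  have hη := h.intensity_eq_rate hx
  rw [intensity] at hη
  field_simp at hη ⊢
  linear_combination -hη - h.param.eqn

theorem inner_deriv_eq (h : IsCuspon c κ α v a) (hx : 0 < x) :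
    ⟪v x, deriv v x⟫_ℝ = rate κ α v x * intensity v x / 2 := by
  have hderiv := (h.hasFirstIntegralsOn.hasDerivAt_intensity
    (Filter.mem_of_superset (Ioi_mem_nhds hx) subset_union_right)).deriv
  simp only [deriv_intensity h.param.ne, h.right.deriv_eq hx] at hderiv
  rw [intensity_eq_normalProfile h.param.ne, rate]
  linarith

theorem deriv_eq (h : IsCuspon c κ α v a) (hx : 0 < x) :
    deriv v x = (rate κ α v x ^ 2 - α ^ 2) • (logDeriv c κ (rate κ α v x) * v x) := by
  have hκ := h.param.pos
  have hsq : 0 < rate κ α v x ^ 2 + c ^ 2 := h.param.sq_add_sq_pos (h.lt_rate hx).le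
  have hnorm := norm_sq_smul_eq_inner (v x) (deriv v x)
  have hnorm_pos : ‖v x‖ ^ 2 ≠ 0 := pow_ne_zero 2 (norm_ne_zero_iff.2 (h.ne_zero (Or.inr hx)))
  have hcoeff : ‖v x‖ ^ 2 * ((rate κ α v x ^ 2 - α ^ 2) *
      ((2 * κ - 1) / (2 * (rate κ α v x ^ 2 + c ^ 2)))) = intensity v x / 2 := by
    rw [h.norm_sq_eq_rate hx, h.intensity_eq_rate hx]
    field_simp
  refine smul_right_injective ℂ hnorm_pos ?_
  simp only
  rw [hnorm, h.inner_deriv_eq hx, h.hasFirstIntegralsOn.momentum x (Or.inr hx), logDeriv,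
    smul_mul_assoc, smul_smul, smul_smul, mul_assoc (‖v x‖ ^ 2), hcoeff]
  simp only [Complex.real_smul]
  push_cast
  ring

theorem isDrivenOn {A : Type*} [NormedRing A] [NormedAlgebra ℝ A] (h : IsCuspon c κ α v a)
    {H u : ℝ → A} (hH : ContDiffOn ℝ ∞ H (regularSet c)) (hu : ∀ x, 0 < x →
      HasDerivAt u ((rate κ α v x ^ 2 - α ^ 2) • (H (rate κ α v x) * u x)) x) :
    IsDrivenOn (fun s => s ^ 2 - α ^ 2) (fun s => -((1 + κ * s ^ 2) / (2 * (1 + κ * α ^ 2)))) H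
      (regularSet c) (Ioi 0) (rate κ α v) u where
  isOpen_coeff := isOpen_regularSet c
  isOpen := isOpen_Ioi
  mapsTo _ hx := h.rate_mem_regularSet hx
  contDiff_weight := by fun_prop
  contDiffOn_drift := ContDiff.contDiffOn (by fun_prop)
  contDiffOn_coeff := hH
  hasDerivAt_driver _ hx := h.hasDerivAt_rate hx
  hasDerivAt := hu

theorem isDrivenOn_self (h : IsCuspon c κ α v a) :
    IsDrivenOn (fun s => s ^ 2 - α ^ 2) (fun s => -((1 + κ * s ^ 2) / (2 * (1 + κ * α ^ 2))))
      (logDeriv c κ) (regularSet c) (Ioi 0) (rate κ α v) v :=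
  h.isDrivenOn (contDiffOn_logDeriv c κ) fun _ hx => h.deriv_eq hx ▸
    h.hasFirstIntegralsOn.hasDerivAt
      (Filter.mem_of_superset (Ioi_mem_nhds hx) subset_union_right)

theorem isDrivenOn_one (h : IsCuspon c κ α v a) :
    IsDrivenOn (fun s => s ^ 2 - α ^ 2) (fun s => -((1 + κ * s ^ 2) / (2 * (1 + κ * α ^ 2))))
      (0 : ℝ → ℝ) (regularSet c) (Ioi 0) (rate κ α v) 1 :=
  h.isDrivenOn contDiffOn_const fun x _ => by
    simpa only [Pi.zero_apply, zero_mul, smul_zero] using! hasDerivAt_const x (1 : ℝ)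

theorem hasWeightOn_deriv (h : IsCuspon c κ α v a) :
    HasWeightOn (regularSet c) (Ioi 0) (rate κ α v) v (fun s => s ^ 2 - α ^ 2) (deriv v) :=
  ⟨logDeriv c κ, contDiffOn_logDeriv c κ, fun _ hx => h.deriv_eq hx⟩

theorem hasWeightOn_intensity (h : IsCuspon c κ α v a) :
    HasWeightOn (regularSet c) (Ioi 0) (rate κ α v) 1 (fun s => s ^ 2 - α ^ 2)
      (intensity v) := by
  have hκ := h.param.pos
  refine ⟨fun s => (2 * κ - 1) / (2 * (1 + κ * s ^ 2)), ContDiff.contDiffOn <|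
    contDiff_const.div (by fun_prop) fun s => by positivity, fun x hx => ?_⟩
  rw [h.intensity_eq_rate hx, Pi.one_apply, mul_one, smul_eq_mul]

theorem norm_le (h : IsCuspon c κ α v a) (hx : 0 < x) : ‖v x‖ ≤ √(1 + 1 / (2 * κ)) := by
  obtain ⟨hpos, hlt⟩ := h.right.mem_Ioo hx
  have hη := intensity_eq_normalProfile h.param.ne v x
  have hmul : 0 ≤ κ * normalProfile κ v x := (mul_pos h.param.pos hpos).le
  rw [intensity] at hη
  exact Real.le_sqrt_of_sq_le (by linarith)

/-- The coefficient of a weighted function stays bounded because the rate stays in the compact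
interval `[α, rate 1]`. -/
theorem exists_norm_le_of_hasWeightOn {A : Type*} [NormedRing A] [NormedAlgebra ℝ A]
    (h : IsCuspon c κ α v a) {u F : ℝ → A} {m : ℝ → ℝ} {C : ℝ} (hu : ∀ x, 0 < x → ‖u x‖ ≤ C)
    (hm : ∀ s, α ≤ s → 0 ≤ m s) (hF : HasWeightOn (regularSet c) (Ioi 0) (rate κ α v) u m F) :
    ∃ M, 0 ≤ M ∧ ∀ x, 1 ≤ x → ‖F x‖ ≤ M * m (rate κ α v x) := by
  obtain ⟨H, hH, hFH⟩ := hF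
  obtain ⟨B, hB⟩ := (isCompact_Icc (a := α) (b := rate κ α v 1)).exists_bound_of_continuousOn
    (hH.continuousOn.mono fun s hs => (h.param.sq_add_sq_pos hs.1).ne')
  have hB_rate : ∀ x, 1 ≤ x → ‖H (rate κ α v x)‖ ≤ B := fun x hx =>
    have hx₀ : 0 < x := one_pos.trans_le hx
    hB _ ⟨(h.lt_rate hx₀).le, h.right.antitoneOn_slope (mem_Ioi.2 one_pos) hx₀ hx⟩
  have hB₀ : 0 ≤ B := (norm_nonneg _).trans (hB_rate 1 le_rfl)
  have hC₀ : 0 ≤ C := (norm_nonneg _).trans (hu 1 one_pos)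
  refine ⟨B * C, mul_nonneg hB₀ hC₀, fun x hx => ?_⟩
  have hx₀ : 0 < x := one_pos.trans_le hx
  have hm₀ : 0 ≤ m (rate κ α v x) := hm _ (h.lt_rate hx₀).le
  calc ‖F x‖ = m (rate κ α v x) * ‖H (rate κ α v x) * u x‖ := by
        rw [hFH x hx₀, norm_smul, Real.norm_of_nonneg hm₀]
    _ ≤ m (rate κ α v x) * (B * C) := by
        gcongr
        exact (norm_mul_le _ _).trans (mul_le_mul (hB_rate x hx) (hu x hx₀) (norm_nonneg _) hB₀)
    _ = B * C * m (rate κ α v x) := mul_comm _ _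

theorem exists_norm_add_abs_le (h : IsCuspon c κ α v a) {F : ℝ → ℂ} {G m : ℝ → ℝ}
    (hm : ∀ s, α ≤ s → 0 ≤ m s) (hF : HasWeightOn (regularSet c) (Ioi 0) (rate κ α v) v m F)
    (hG : HasWeightOn (regularSet c) (Ioi 0) (rate κ α v) 1 m G) :
    ∃ M, 0 < M ∧ ∀ x, 1 ≤ x → ‖F x‖ + |G x| ≤ M * m (rate κ α v x) := by
  obtain ⟨M, hM, hFM⟩ := h.exists_norm_le_of_hasWeightOn (fun _ => h.norm_le) hm hF
  obtain ⟨N, hN, hGN⟩ := h.exists_norm_le_of_hasWeightOn (fun _ _ => norm_one.le) hm hG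
  refine ⟨M + N + 1, by positivity, fun x hx => ?_⟩
  have hm₀ : 0 ≤ m (rate κ α v x) := hm _ (h.lt_rate (one_pos.trans_le hx)).le
  linarith [hFM x hx, Real.norm_eq_abs (G x) ▸ hGN x hx]

theorem exponential_decay (h : IsCuspon c κ α v a) (hα : 0 < α) (j : ℕ) :
    ∃ C₁ C₂ : ℝ, 0 < C₁ ∧ 0 < C₂ ∧ ∀ x, 1 ≤ x →
      ‖iteratedDeriv j (deriv v) x‖ + |iteratedDeriv j (intensity v) x|
        ≤ C₁ * Real.exp (-C₂ * x) := by
  obtain ⟨M, hM, hle⟩ := h.exists_norm_add_abs_le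
    (fun s hs => sub_nonneg.2 (pow_le_pow_left₀ hα.le hs 2))
    (h.hasWeightOn_deriv.iteratedDeriv_self h.isDrivenOn_self j)
    (h.hasWeightOn_intensity.iteratedDeriv_self h.isDrivenOn_one j)
  obtain ⟨C, hC, hrate⟩ := h.right.exists_slope_sq_sub_le
  refine ⟨M * C, α, mul_pos hM hC, hα, fun x hx => (hle x hx).trans ?_⟩
  rw [mul_assoc]
  exact mul_le_mul_of_nonneg_left (hrate x hx) hM.le

theorem algebraic_decay (h : IsCuspon c κ α v a) (hα : α = 0) (j : ℕ) :
    ∃ C₃ : ℝ, 0 < C₃ ∧ ∀ x, 1 ≤ x →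
      ‖iteratedDeriv j (deriv v) x‖ + |iteratedDeriv j (intensity v) x|
        ≤ C₃ * x ^ (-(2 + (j : ℤ))) := by
  subst hα
  have hw : ∀ s : ℝ, s ^ 2 - 0 ^ 2 = s ^ 2 := fun s => by simp
  obtain ⟨M, hM, hle⟩ := h.exists_norm_add_abs_le (fun s hs => pow_nonneg hs _)
    (h.hasWeightOn_deriv.iteratedDeriv_sq h.isDrivenOn_self hw j)
    (h.hasWeightOn_intensity.iteratedDeriv_sq h.isDrivenOn_one hw j)
  refine ⟨M * 2 ^ (2 + j), by positivity, fun x hx => (hle x hx).trans ?_⟩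
  have hx₀ : 0 < x := one_pos.trans_le hx
  have hzpow : x ^ (-(2 + (j : ℤ))) = (x ^ (2 + j))⁻¹ := by
    rw [zpow_neg, ← Nat.cast_ofNat, ← Nat.cast_add, zpow_natCast]
  rw [mul_assoc, hzpow, ← div_eq_mul_inv, ← div_pow]
  gcongr
  · exact (h.lt_rate hx₀).le
  · exact h.right.slope_le_two_div hx₀

end IsCuspon
end Decay

end Cuspon

/-- A finite-energy weak solution `u` has a continuous representative `v` (unique, as two
continuous functions that agree almost everywhere are equal), and `v` has the stated cuspon
profile outside `[a, 0]`, `a = inf Γ(v)`, if it is singular (not `C²`) and `Γ(v)` is nonempty and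
bounded with supremum `0`. -/
theorem theorem1p3 (c κ : ℝ) (hcκ : (c, κ) ∈ Cuspon.DTilde) (u : ℝ → ℂ)
    (hu : u ∈ Cuspon.EnergySpace) (hsol : Cuspon.IsWeakSolution c κ u) :
    ∃ v : ℝ → ℂ, Continuous v ∧ v =ᵐ[volume] u ∧
      (¬ ContDiff ℝ 2 v →
        (Cuspon.criticalSet κ v).Nonempty →
        Bornology.IsBounded (Cuspon.criticalSet κ v) →
        sSup (Cuspon.criticalSet κ v) = 0 →
        ∀ (a : ℝ) (η : ℝ → ℝ), a = sInf (Cuspon.criticalSet κ v) → η = Cuspon.intensity v →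
          -- explicit profile on the right
          ((c, κ) ∈ Cuspon.D1 →
            Cuspon.EqInverseOnNonneg η (Cuspon.profileF c κ) (Cuspon.intervalT κ)) ∧
          ((c, κ) ∈ Cuspon.D3 →
            Cuspon.EqInverseOnNonneg η (Cuspon.profileH c κ) (Cuspon.intervalJ κ)) ∧
          ((c, κ) ∈ Cuspon.BMinus →
            Cuspon.EqInverseOnNonneg η (Cuspon.profileG κ) (Cuspon.intervalT κ)) ∧
          ((c, κ) ∈ Cuspon.BPlus →
            Cuspon.EqInverseOnNonneg η (Cuspon.profileGTilde κ) (Cuspon.intervalJ κ)) ∧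
          -- reflection on the left
          (∀ x, x ≤ a → η x = η (a - x)) ∧
          -- range
          ((c, κ) ∈ Cuspon.D1 ∪ Cuspon.BMinus →
            ∀ x ∈ Iio a ∪ Ioi 0, 1 - 1 / (2 * κ) < η x ∧ η x < 0) ∧
          ((c, κ) ∈ Cuspon.D3 ∪ Cuspon.BPlus →
            ∀ x ∈ Iio a ∪ Ioi 0, 0 < η x ∧ η x < 1 - 1 / (2 * κ)) ∧
          -- polar form and phase
          (∃ θ : ℝ → ℝ, ∀ x ∈ Iio a ∪ Ioi 0,
            v x = (√(1 - η x) : ℂ) * Complex.exp (Complex.I * (θ x : ℂ)) ∧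
            HasDerivAt θ (c * η x / (2 - 2 * η x)) x) ∧
          -- regularity
          ContDiffOn ℝ ∞ v (Iio a ∪ Ioi 0) ∧
          -- one-sided limits of the derivative of the profile
          ((c, κ) ∈ Cuspon.D1 ∪ Cuspon.BMinus →
            Tendsto (deriv η) (𝓝[<] a) atBot ∧ Tendsto (deriv η) (𝓝[>] 0) atTop) ∧
          ((c, κ) ∈ Cuspon.D3 ∪ Cuspon.BPlus →
            Tendsto (deriv η) (𝓝[<] a) atTop ∧ Tendsto (deriv η) (𝓝[>] 0) atBot) ∧
          -- decay
          ((c, κ) ∈ Cuspon.D1 ∪ Cuspon.D3 →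
            ∀ j : ℕ, ∃ C₁ C₂ : ℝ, 0 < C₁ ∧ 0 < C₂ ∧ ∀ x, 1 ≤ x →
              ‖iteratedDeriv j (deriv v) x‖ + |iteratedDeriv j η x|
                ≤ C₁ * Real.exp (-C₂ * x)) ∧
          ((c, κ) ∈ Cuspon.BPlus ∪ Cuspon.BMinus →
            ∀ j : ℕ, ∃ C₃ : ℝ, 0 < C₃ ∧ ∀ x, 1 ≤ x →
              ‖iteratedDeriv j (deriv v) x‖ + |iteratedDeriv j η x|
                ≤ C₃ * x ^ (-(2 + (j : ℤ))))) := by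
  obtain ⟨α, hp⟩ := Cuspon.exists_isCuspParam hcκ
  obtain ⟨v, g, hvu, hv⟩ := Cuspon.exists_isFiniteEnergySolution hu hsol
  refine ⟨v, hv.continuous, hvu, ?_⟩
  rintro - hne hbdd hsup a η rfl rfl
  have h := hv.isCuspon hp hne hbdd hsup
  have hneg := Cuspon.two_mul_sub_one_neg (c := c) (κ := κ)
  have hpos := Cuspon.two_mul_sub_one_pos (c := c) (κ := κ)
  have hT hD ξ := Cuspon.mul_mem_intervalT_iff (ξ := ξ) hp.pos (hneg hD)
  have hJ hD ξ := Cuspon.mul_mem_intervalJ_iff (ξ := ξ) hp.pos (hpos hD)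
  exact ⟨fun hD => h.eqInverse_profileF (hp.pos_of_mem (Or.inl hD)) (hT (Or.inl hD)),
    fun hD => h.eqInverse_profileF (hp.pos_of_mem (Or.inr hD)) (hJ (Or.inl hD)),
    fun hB => h.eqInverse_profileG (hp.eq_zero_of_mem (Or.inr hB)) (hT (Or.inr hB)),
    fun hB => h.eqInverse_profileG (hp.eq_zero_of_mem (Or.inl hB)) (hJ (Or.inr hB)),
    fun _ => h.intensity_reflect,
    fun hD _ => h.intensity_mem_Ioo_of_neg (hneg hD),
    fun hD _ => h.intensity_mem_Ioo_of_pos (hpos hD),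
    h.exists_phase,
    h.hasFirstIntegralsOn.contDiffOn,
    fun hD => h.tendsto_deriv_of_neg (hneg hD),
    fun hD => h.tendsto_deriv_of_pos (hpos hD),
    fun hD => h.exponential_decay (hp.pos_of_mem hD),
    fun hB => h.algebraic_decay (hp.eq_zero_of_mem hB)⟩
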